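/- There are absolute constants $C, C'>0$ such that the following holds. Let $k\ge 2$ be an integer, $0<\rho<1$, and let $\mu_0,\mu_1,\dots,\mu_k$ be probability distributions on the same measurable space $\Omega$ such that $\{\mu_1,\dots,\mu_k\}$ is a $\rho$-centered family around $\mu_0$, that is, $(1-\rho)\mu_0(E)\le \mu_i(E)\le (1+\rho)\mu_0(E)$ for every event $E$ and every $1\le i\le k$. Let $m,n\ge 1$ be integers and write $\frac{\mu_i(A)}{\mu_0(A)}$ for the likelihood ratio $\frac{d\mu_i}{d\mu_0}(A)$. Consider the condition \[ \sum_{S\subseteq\{1,\dots,k\},\ |S|\ge 2} n^{-|S|/2}\rho^{-|S|}\left|\mathbb{E}_{A\sim\mu_0}\prod_{i\in S}\left(\frac{\mu_i(A)}{\mu_0(A)}-1\right)\right|\le \frac1n .\tag{1} \] (a) If $\rho\le (n\ln k)^{-1/2}/C'$ and (1) holds, then every $(m,n)$-protocol identifying $\mu\in\{\mu_1,\dots,\mu_k\}$ with error $1/3$ has communication complexity at least \[ \frac{k}{C\rho^2 n\log\left(k/(n\rho^2)\right)} . \] (b) Condition (1) holds whenever there is an integer $\ell\ge 2$ such that all terms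 of the sum in (1) with $2\le |S|\le \ell$ vanish and $n\ge k^{2(\ell+1)/(\ell-1)}$. Here an $(m,n)$-protocol identifying $\mu\in\{\mu_1,\dots,\mu_k\}$ with error $\varepsilon$ is a randomized $m$-party protocol in which each party's input is a tuple of $n$ points of $\Omega$ and the parties communicate by broadcasting bits: the history of bits sent so far (and the randomness) determines which party sends the next bit, or that the protocol halts; each bit sent is a function of the sender's own input, the history and the randomness; and upon halting an index in $\{1,\dots,k\}$ is output as a function of the history and the randomness. The randomness is a seed independent of the inputs, which may be shared by all parties (private randomness being a special case). It is required that for every $i$, if all $mn$ input points are drawn independently from $\mu_i$, the protocol halts and outputs $i$ with probability at least $1-\varepsilon$. Its communication complexity is the maximal total number of bits sent, over all inputs and all values of the randomness. -/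

import Mathlib

open MeasureTheory
open scoped ENNReal

noncomputable section

/-- `μ 0, …, μ (k-1)` is a `ρ`-centered family of distributions, centered around `μ₀`. -/
structure IsCenteredFamily {Ω : Type*} [MeasurableSpace Ω] {k : ℕ} (ρ : ℝ)
    (μ₀ : Measure Ω) (μ : Fin k → Measure Ω) : Prop where
  rho_pos : 0 < ρ
  rho_lt_one : ρ < 1
  two_le : 2 ≤ k
  prob_center : IsProbabilityMeasure μ₀
  prob : ∀ i, IsProbabilityMeasure (μ i)
  lower : ∀ i (E : Set Ω), MeasurableSet E → (1 - ρ) * μ₀.real E ≤ (μ i).real E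
  upper : ∀ i (E : Set Ω), MeasurableSet E → (μ i).real E ≤ (1 + ρ) * μ₀.real E

/-- The term `n^{-|S|/2} ρ^{-|S|} |E_{A ∼ μ₀} ∏_{i ∈ S} (μ_i(A)/μ₀(A) - 1)|`, where the likelihood
ratio `μ_i(A)/μ₀(A)` is the Radon–Nikodym derivative. -/
def corrTerm {Ω : Type*} [MeasurableSpace Ω] {k : ℕ} (n : ℕ) (ρ : ℝ)
    (μ₀ : Measure Ω) (μ : Fin k → Measure Ω) (S : Finset (Fin k)) : ℝ :=
  (n : ℝ) ^ (-(S.card : ℝ) / 2) * ρ ^ (-(S.card : ℝ)) *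
    |∫ a, ∏ i ∈ S, (((μ i).rnDeriv μ₀ a).toReal - 1) ∂μ₀|

/-- The weighted correlations of order at least two sum to at most `1/n`. -/
def CorrCondition {Ω : Type*} [MeasurableSpace Ω] {k : ℕ} (n : ℕ) (ρ : ℝ)
    (μ₀ : Measure Ω) (μ : Fin k → Measure Ω) : Prop :=
  ∑ S : Finset (Fin k) with 2 ≤ S.card, corrTerm n ρ μ₀ μ S ≤ 1 / (n : ℝ)

/-- A randomized `m`-party broadcast protocol in which every party holds an input from `X` and which
outputs an element of `Fin k`.

Messages are broadcast bit by bit, and the history is the list of all bits sent so far; a longer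
message is a run of consecutive bits of one party. Given the history, `next` says which party
sends the next bit (`none`: the protocol halts); that bit depends on the speaker's own input, the
randomness and the history. There is no bound on the number of rounds.

The random seed `r : R` is common to all parties. Private coins are the special case in which `r`
is a tuple of independent seeds of which party `j` uses only the `j`-th one. -/
structure Protocol (m k : ℕ) (X R : Type*) [MeasurableSpace X] [MeasurableSpace R] where
  coins : Measure R
  prob_coins : IsProbabilityMeasure coins
  next : R → List Bool → Option (Fin m)
  bit : Fin m → X → R → List Bool → Bool
  output : R → List Bool → Fin k
  measurableSet_next : ∀ h o, MeasurableSet {r | next r h = o}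
  measurable_bit : ∀ j h, Measurable fun p : X × R => bit j p.1 p.2 h
  measurableSet_output : ∀ h i, MeasurableSet {r | output r h = i}

namespace Protocol

variable {m k : ℕ} {X R : Type*} [MeasurableSpace X] [MeasurableSpace R]

/-- The history after (at most) `t` bits, on seed `r` and inputs `x`. -/
def history (π : Protocol m k X R) (r : R) (x : Fin m → X) : ℕ → List Bool
  | 0 => []
  | t + 1 =>
    match π.next r (π.history r x t) with
    | none => π.history r x t
    | some j => π.history r x t ++ [π.bit j (x j) r (π.history r x t)]

/-- On seed `r` and inputs `x` the protocol halts and outputs `i`. -/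
def Outputs (π : Protocol m k X R) (r : R) (x : Fin m → X) (i : Fin k) : Prop :=
  ∃ t, π.next r (π.history r x t) = none ∧ π.output r (π.history r x t) = i

/-- The maximal number of bits sent, over all inputs and all seeds (`⊤` if unbounded). -/
def communicationComplexity (π : Protocol m k X R) : ℕ∞ :=
  ⨆ (r : R) (x : Fin m → X) (t : ℕ), ((π.history r x t).length : ℕ∞)

/-- `π` is an `(m,n)`-protocol identifying `μ ∈ {μ 0, …, μ (k-1)}` with error `ε`: if each of the
`m` parties receives `n` independent samples from `μ i`, the output is `i` with probability at
least `1 - ε`, for every `i`. -/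
def Identifies {Ω : Type*} [MeasurableSpace Ω] {n : ℕ} (π : Protocol m k (Fin n → Ω) R)
    (μ : Fin k → Measure Ω) (ε : ℝ) : Prop :=
  ∀ i, 1 - ε ≤
    (π.coins.prod (Measure.pi fun _ : Fin m => Measure.pi fun _ : Fin n => μ i)).real
      {p | π.Outputs p.1 p.2 i}

end Protocol

end

/-!
Write `x = k / (n ρ²)` and let `Zᵢ` be the deviation from `1` of the likelihood ratio of `n` samples
from `μᵢ` against `n` samples from `μ₀`. A nonnegative multilinear surrogate for `exp (θ * Zᵢ)`
has joint moments over the samples that factor into `n` one-sample sums, each at most `1 + 1/n`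
by condition (1). As `(1 + 1/n) ^ n ≤ e`, the `Zᵢ` have joint exponential moments as if they were
independent and sub-Gaussian of variance of order `n ρ²`. After conditioning on the likely event
that every `|Zᵢ|` is at most of order `ρ √(n log x)`, Jensen's inequality turns this into a
level-one inequality: for an event `E` of probability `p` under the conditioned null law, the
squared relative deviations of the `k` probabilities of `E` sum to
`O(n ρ² log x * (1 + log (1/p)))`.

The inputs compatible with a transcript of `B` bits form a rectangle with at most `B` nontrivial
sides. The Hellinger affinity of the transcript laws under `μ₀` and `μᵢ` loses at most the expected
sum of the squared deviations of these sides, the linear terms cancelling because probabilities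
sum to one. Summed over `i`, the level-one inequality and the entropy bound `O(B + 1)` on
transcripts leave a total loss of `O(n ρ² log x * B)`, whereas identifying every `μᵢ` forces a
constant loss for most `i`; hence `B` is at least of order `k / (n ρ² log x)`.

For part (b), `|𝔼 ∏ᵢ (dμᵢ/dμ₀ - 1)| ≤ ρ ^ |S|` bounds each surviving term of (1) by `n ^ (-|S|/2)`,
which is at most `k ^ (-|S|) / n` when `|S| > ℓ`.
-/

/-! ### The deviation of a likelihood ratio and its tilt weights -/

section TiltWeight

variable {τ : Type*} [Fintype τ]

/-- The deviation from `1` of a product likelihood ratio whose factors are `1 + g t`. -/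
noncomputable def likelihoodDev (g : τ → ℝ) : ℝ :=
  ∏ t, (1 + g t) - 1

/-- A multilinear polynomial in the entries of `g` that serves as a nonnegative surrogate for
`exp (θ * likelihoodDev g)`: in the second-order term, `likelihoodDev (2 • g) - 2 * likelihoodDev g`
replaces the square of `likelihoodDev g`, which is not multilinear. -/
noncomputable def tiltWeight (θ : ℝ) (g : τ → ℝ) : ℝ :=
  1 + θ * likelihoodDev g + 2 * θ ^ 2 * (likelihoodDev ((2 : ℝ) • g) - 2 * likelihoodDev g)

/-- The coefficient of the monomials of degree `d` in `tiltWeight θ`. -/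
noncomputable def tiltCoeff (θ : ℝ) (d : ℕ) : ℝ :=
  if d = 0 then 1 else θ + 2 * θ ^ 2 * (2 ^ d - 2)

theorem likelihoodDev_smul_eq_sum [DecidableEq τ] (c : ℝ) (g : τ → ℝ) :
    likelihoodDev (c • g) =
      ∑ A : Finset τ, if A = ∅ then 0 else c ^ A.card * ∏ t ∈ A, g t := by
  have expand : ∏ t, (1 + (c • g) t) = ∑ A : Finset τ, c ^ A.card * ∏ t ∈ A, g t := by
    simp [Finset.prod_one_add, Finset.prod_mul_distrib]
  have split : ∀ A : Finset τ, c ^ A.card * ∏ t ∈ A, g t =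
      (if A = ∅ then 1 else 0) + if A = ∅ then 0 else c ^ A.card * ∏ t ∈ A, g t := by
    intro A
    split_ifs with hA <;> simp [hA]
  rw [likelihoodDev, expand, Finset.sum_congr rfl fun A _ => split A, Finset.sum_add_distrib]
  simp

theorem tiltWeight_eq_sum (θ : ℝ) (g : τ → ℝ) :
    tiltWeight θ g = ∑ A : Finset τ, tiltCoeff θ A.card * ∏ t ∈ A, g t := by
  classical
  have h1 := likelihoodDev_smul_eq_sum 1 g
  have h2 := likelihoodDev_smul_eq_sum 2 g
  have h0 : (1 : ℝ) = ∑ A : Finset τ, if A = ∅ then 1 else 0 := by simp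
  simp only [one_smul, one_pow, one_mul] at h1
  rw [tiltWeight, h1, h2, h0]
  simp only [Finset.mul_sum, ← Finset.sum_add_distrib, ← Finset.sum_sub_distrib]
  refine Finset.sum_congr rfl fun A _ => ?_
  by_cases hA : A = ∅
  · simp [hA, tiltCoeff]
  · simp only [tiltCoeff, hA, Finset.card_eq_zero, if_false]
    ring

theorem abs_tiltCoeff_le {ε θ : ℝ} (hε : 0 < ε) (hε' : ε ≤ 1 / 4) (hθ : |θ| * ε ≤ 1 / 16)
    (d : ℕ) : |tiltCoeff θ d| ≤ (ε ^ d)⁻¹ := by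
  rw [← one_div, le_div_iff₀ (by positivity)]
  rcases d with _ | _ | d
  · simp [tiltCoeff]
  · simp only [tiltCoeff, zero_add, one_ne_zero, if_false, pow_one, sub_self, mul_zero, add_zero]
    linarith
  have h_two_le : (2 : ℝ) ≤ 2 ^ (d + 2) := by
    simpa using pow_le_pow_right₀ (one_le_two (α := ℝ)) (show 1 ≤ d + 2 by lia)
  have h_abs : |tiltCoeff θ (d + 2)| ≤ |θ| + 2 * |θ| ^ 2 * 2 ^ (d + 2) := by
    rw [tiltCoeff, if_neg (by lia), sq_abs]
    refine (abs_add_le _ _).trans ?_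
    rw [abs_of_nonneg (a := 2 * θ ^ 2 * (2 ^ (d + 2) - 2)) (by nlinarith [sq_nonneg θ])]
    nlinarith [sq_nonneg θ]
  have h_pow : ε ^ d ≤ 1 := pow_le_one₀ hε.le (by linarith)
  have h_two_pow : (2 * ε) ^ d ≤ 1 := pow_le_one₀ (by linarith) (by linarith)
  calc |tiltCoeff θ (d + 2)| * ε ^ (d + 2)
      ≤ (|θ| + 2 * |θ| ^ 2 * 2 ^ (d + 2)) * ε ^ (d + 2) := by gcongr
    _ = |θ| * ε * ε * ε ^ d + 8 * (|θ| * ε) ^ 2 * (2 * ε) ^ d := by rw [mul_pow]; ring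
    _ ≤ 1 / 16 * (1 / 4) * 1 + 8 * (1 / 16) ^ 2 * 1 := by gcongr
    _ ≤ 1 := by norm_num

theorem abs_le_of_sum_sq_le {ε : ℝ} {g : τ → ℝ} (hε : 0 ≤ ε) (hg : ∑ t, g t ^ 2 ≤ ε ^ 2) (t : τ) :
    |g t| ≤ ε :=
  abs_le_of_sq_le_sq
    ((Finset.single_le_sum (fun _ _ => sq_nonneg _) (Finset.mem_univ t)).trans hg) hε

theorem sq_prod_one_add_le {ε : ℝ} {g : τ → ℝ} (hε : 0 ≤ ε) (hε' : ε ≤ 1 / 4)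
    (hg : ∑ t, g t ^ 2 ≤ ε ^ 2) :
    (∏ t, (1 + g t)) ^ 2 ≤ (1 + 4 * ε ^ 2) * ∏ t, (1 + 2 * g t) := by
  have hg_ge : ∀ t, -(1 / 4) ≤ g t := fun t =>
    (abs_le.1 ((abs_le_of_sum_sq_le hε hg t).trans hε')).1
  have h_factor : ∏ t, (1 + 2 * g t ^ 2) ≤ 1 + 4 * ε ^ 2 := by
    calc ∏ t, (1 + 2 * g t ^ 2) ≤ Real.exp (∑ t, 2 * g t ^ 2) :=
          Real.prod_one_add_le_exp_sum _ fun t => by positivity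
      _ ≤ Real.exp (2 * ε ^ 2) := by rw [← Finset.mul_sum]; gcongr
      _ ≤ 1 + 4 * ε ^ 2 := by
          have h := (abs_le.1 (Real.abs_exp_sub_one_sub_id_le (x := 2 * ε ^ 2)
            (by rw [abs_of_nonneg (by positivity)]; nlinarith))).2
          nlinarith [sq_nonneg ε, show ε ^ 2 ≤ 1 / 16 by nlinarith]
  calc (∏ t, (1 + g t)) ^ 2 = ∏ t, (1 + g t) ^ 2 := (Finset.prod_pow ..).symm
    _ ≤ ∏ t, ((1 + 2 * g t ^ 2) * (1 + 2 * g t)) :=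
        Finset.prod_le_prod (fun _ _ => sq_nonneg _) fun t _ => by
          nlinarith [mul_nonneg (sq_nonneg (g t)) (show 0 ≤ g t + 1 / 4 by linarith [hg_ge t])]
    _ = (∏ t, (1 + 2 * g t ^ 2)) * ∏ t, (1 + 2 * g t) := Finset.prod_mul_distrib
    _ ≤ (1 + 4 * ε ^ 2) * ∏ t, (1 + 2 * g t) := by
        gcongr
        exact Finset.prod_nonneg fun t _ => by linarith [hg_ge t]

theorem sq_likelihoodDev_le {ε : ℝ} {g : τ → ℝ} (hε : 0 ≤ ε) (hε' : ε ≤ 1 / 4)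
    (hg : ∑ t, g t ^ 2 ≤ ε ^ 2) :
    likelihoodDev g ^ 2 / 2 - 8 * ε ^ 2 ≤ likelihoodDev ((2 : ℝ) • g) - 2 * likelihoodDev g := by
  have h := sq_prod_one_add_le hε hε' hg
  have h_dev : ∏ t, (1 + g t) = 1 + likelihoodDev g := by rw [likelihoodDev]; ring
  have h_dev_two : ∏ t, (1 + 2 * g t) = 1 + likelihoodDev ((2 : ℝ) • g) := by simp [likelihoodDev]
  rw [h_dev, h_dev_two] at h
  set Z := likelihoodDev g
  set W := likelihoodDev ((2 : ℝ) • g)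
  have hε_sq : ε ^ 2 ≤ 1 / 16 := by nlinarith
  have hW : 0 ≤ 1 + W := by
    by_contra! hneg
    nlinarith [sq_nonneg (1 + Z), sq_nonneg ε]
  have h_inv : (1 - 4 * ε ^ 2) * (1 + Z) ^ 2 ≤ 1 + W := by
    have := mul_le_mul_of_nonneg_left h (show 0 ≤ 1 - 4 * ε ^ 2 by linarith)
    nlinarith [mul_nonneg (sq_nonneg (ε ^ 2)) hW]
  nlinarith [mul_nonneg (sq_nonneg ε) (sq_nonneg (1 - Z)),
    mul_nonneg (sub_nonneg.2 hε_sq) (sq_nonneg Z)]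

theorem le_tiltWeight {ε : ℝ} {g : τ → ℝ} (hε : 0 ≤ ε) (hε' : ε ≤ 1 / 4)
    (hg : ∑ t, g t ^ 2 ≤ ε ^ 2) (θ : ℝ) :
    1 + θ * likelihoodDev g + (θ * likelihoodDev g) ^ 2 - 16 * (θ * ε) ^ 2 ≤ tiltWeight θ g := by
  have := mul_le_mul_of_nonneg_left (sq_likelihoodDev_le hε hε' hg)
    (show 0 ≤ 2 * θ ^ 2 by positivity)
  rw [tiltWeight]
  linarith

theorem sq_mul_le_of_abs_mul_le {ε θ : ℝ} (hε : 0 ≤ ε) (hθ : |θ| * ε ≤ 1 / 16) :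
    (θ * ε) ^ 2 ≤ 1 / 256 := by
  rw [← sq_abs, abs_mul, abs_of_nonneg hε]
  nlinarith [mul_nonneg (abs_nonneg θ) hε]

theorem tiltWeight_nonneg {ε θ : ℝ} {g : τ → ℝ} (hε : 0 ≤ ε) (hε' : ε ≤ 1 / 4)
    (hg : ∑ t, g t ^ 2 ≤ ε ^ 2) (hθ : |θ| * ε ≤ 1 / 16) : 0 ≤ tiltWeight θ g := by
  have h := le_tiltWeight hε hε' hg θ
  nlinarith [sq_nonneg (θ * likelihoodDev g + 1 / 2), sq_mul_le_of_abs_mul_le hε hθ]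

theorem exp_sub_le_one_add_add_sq_sub {u v : ℝ} (hu : |u| ≤ 1) (hv0 : 0 ≤ v) (hv : v ≤ 1 / 256) :
    Real.exp (u - 96 * v) ≤ 1 + u + u ^ 2 - 16 * v := by
  have h_exp_u : Real.exp u ≤ 1 + u + u ^ 2 := by
    linarith [(abs_le.1 (Real.abs_exp_sub_one_sub_id_le hu)).2]
  have h_exp_v : Real.exp (-(96 * v)) ≤ 1 - 48 * v := by
    rw [Real.exp_neg, inv_le_comm₀ (Real.exp_pos _) (by linarith)]
    refine le_trans ?_ (Real.add_one_le_exp _)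
    rw [inv_le_iff_one_le_mul₀ (by linarith)]
    nlinarith
  have h_third : 1 / 3 ≤ Real.exp u := by
    refine le_trans ?_ (Real.exp_le_exp.2 (abs_le.1 hu).1)
    rw [Real.exp_neg, one_div]
    exact inv_anti₀ (Real.exp_pos _) (by linarith [Real.exp_one_lt_d9])
  calc Real.exp (u - 96 * v) = Real.exp u * Real.exp (-(96 * v)) := by
        rw [← Real.exp_add, sub_eq_add_neg]
    _ ≤ Real.exp u * (1 - 48 * v) := by gcongr
    _ ≤ 1 + u + u ^ 2 - 16 * v := by nlinarith

theorem exp_le_tiltWeight {ε θ : ℝ} {g : τ → ℝ} (hε : 0 ≤ ε) (hε' : ε ≤ 1 / 4)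
    (hg : ∑ t, g t ^ 2 ≤ ε ^ 2) (hθ : |θ| * ε ≤ 1 / 16) (hθg : |θ * likelihoodDev g| ≤ 1) :
    Real.exp (θ * likelihoodDev g - 96 * (θ * ε) ^ 2) ≤ tiltWeight θ g :=
  (exp_sub_le_one_add_add_sq_sub hθg (sq_nonneg _) (sq_mul_le_of_abs_mul_le hε hθ)).trans
    (le_tiltWeight hε hε' hg θ)

theorem exp_sub_two_mul_sq_le_one_add {x : ℝ} (hx : -(1 / 2) ≤ x) :
    Real.exp (x - 2 * x ^ 2) ≤ 1 + x := by
  rw [← neg_sub, Real.exp_neg, inv_le_iff_one_le_mul₀ (Real.exp_pos _)]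
  have := Real.add_one_le_exp (2 * x ^ 2 - x)
  nlinarith [mul_nonneg (sq_nonneg x) (show 0 ≤ 1 + 2 * x by linarith)]

theorem abs_likelihoodDev_le {s : ℝ} {g : τ → ℝ} (hg : ∀ t, |g t| ≤ 1 / 2)
    (hg_sq : 2 * ∑ t, g t ^ 2 ≤ s) (hs : s ≤ 1) (hg_sum : |∑ t, g t| ≤ s) :
    |likelihoodDev g| ≤ 2 * s := by
  have hs0 : 0 ≤ s := (abs_nonneg _).trans hg_sum
  have hg_ge : ∀ t, -(1 / 2) ≤ g t := fun t => (abs_le.1 (hg t)).1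
  have h_upper : ∏ t, (1 + g t) ≤ 1 + 2 * s := by
    calc ∏ t, (1 + g t) ≤ ∏ t, Real.exp (g t) :=
          Finset.prod_le_prod (fun t _ => by linarith [hg_ge t]) fun t _ => by
            linarith [Real.add_one_le_exp (g t)]
      _ ≤ Real.exp s := by rw [← Real.exp_sum]; gcongr; exact (abs_le.1 hg_sum).2
      _ ≤ 1 + 2 * s := by
          have := (abs_le.1 (Real.abs_exp_sub_one_sub_id_le (abs_le.2 ⟨by linarith, hs⟩))).2
          nlinarith
  have h_lower : 1 - 2 * s ≤ ∏ t, (1 + g t) := by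
    calc 1 - 2 * s ≤ ∑ t, (g t - 2 * g t ^ 2) + 1 := by
          rw [Finset.sum_sub_distrib, ← Finset.mul_sum]
          linarith [(abs_le.1 hg_sum).1]
      _ ≤ Real.exp (∑ t, (g t - 2 * g t ^ 2)) := Real.add_one_le_exp _
      _ = ∏ t, Real.exp (g t - 2 * g t ^ 2) := Real.exp_sum _ _
      _ ≤ ∏ t, (1 + g t) := Finset.prod_le_prod (fun _ _ => (Real.exp_pos _).le)
          fun t _ => exp_sub_two_mul_sq_le_one_add (hg_ge t)
  rw [likelihoodDev, abs_le]
  constructor <;> linarith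

end TiltWeight

/-! ### Joint expectation of tilt weights -/

section JointExpectation

variable {Ω κ τ : Type*} [MeasurableSpace Ω]

variable {μ₀ : Measure Ω} [IsProbabilityMeasure μ₀] {F : κ → Ω → ℝ} {ρ ε : ℝ} {θ : κ → ℝ}

theorem integrable_prod_of_abs_le (hFm : ∀ i, Measurable (F i)) (hF : ∀ i a, |F i a| ≤ ρ)
    (T : Finset κ) : Integrable (fun a => ∏ i ∈ T, F i a) μ₀ := by
  refine Integrable.of_bound (C := ρ ^ T.card)
    (Finset.measurable_fun_prod T fun i _ => hFm i).aestronglyMeasurable (ae_of_all _ fun a => ?_)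
  rw [Real.norm_eq_abs, Finset.abs_prod, ← Finset.prod_const]
  exact Finset.prod_le_prod (fun _ _ => abs_nonneg _) fun i _ => hF i a

variable [Fintype κ] [Fintype τ]

/-- Transposition of the incidence relation of a family of finite sets. -/
def finsetFamilyTranspose [DecidableEq κ] [DecidableEq τ] :
    (κ → Finset τ) ≃ (τ → Finset κ) where
  toFun A t := {i | t ∈ A i}
  invFun T i := {t | i ∈ T t}
  left_inv A := by ext; simp
  right_inv T := by ext; simp

theorem prod_prod_finsetFamilyTranspose [DecidableEq κ] [DecidableEq τ] {M : Type*} [CommMonoid M]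
    (A : κ → Finset τ) (g : κ → τ → M) :
    ∏ i, ∏ t ∈ A i, g i t = ∏ t, ∏ i ∈ finsetFamilyTranspose A t, g i t :=
  Finset.prod_comm' (by simp [finsetFamilyTranspose])

theorem prod_tiltWeight_eq_sum [DecidableEq κ] [DecidableEq τ] (θ : κ → ℝ) (g : κ → τ → ℝ) :
    ∏ i, tiltWeight (θ i) (g i) = ∑ A : κ → Finset τ,
      (∏ i, tiltCoeff (θ i) (A i).card) * ∏ t, ∏ i ∈ finsetFamilyTranspose A t, g i t := by
  simp_rw [tiltWeight_eq_sum, Finset.prod_univ_sum, Fintype.piFinset_univ, Finset.prod_mul_distrib]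
  exact Finset.sum_congr rfl fun A _ => by rw [prod_prod_finsetFamilyTranspose A g]

theorem integrable_prod_tiltCoeff_mul [DecidableEq κ] [DecidableEq τ]
    (hFm : ∀ i, Measurable (F i)) (hF : ∀ i a, |F i a| ≤ ρ) (θ : κ → ℝ) (A : κ → Finset τ) :
    Integrable (fun x : τ → Ω => (∏ i, tiltCoeff (θ i) (A i).card) *
      ∏ t, ∏ i ∈ finsetFamilyTranspose A t, F i (x t)) (Measure.pi fun _ => μ₀) :=
  (Integrable.fintype_prod fun t =>
    integrable_prod_of_abs_le hFm hF (finsetFamilyTranspose A t)).const_mul _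

theorem integrable_prod_tiltWeight (hFm : ∀ i, Measurable (F i)) (hF : ∀ i a, |F i a| ≤ ρ)
    (θ : κ → ℝ) :
    Integrable (fun x : τ → Ω => ∏ i, tiltWeight (θ i) (F i ∘ x))
      (Measure.pi fun _ => μ₀) := by
  classical
  simp_rw [prod_tiltWeight_eq_sum, Function.comp_apply]
  exact integrable_finsetSum _ fun A _ => integrable_prod_tiltCoeff_mul hFm hF θ A

theorem integral_prod_tiltCoeff_mul_le [DecidableEq κ] [DecidableEq τ] (hε : 0 < ε)
    (hε' : ε ≤ 1 / 4) (hθ : ∀ i, |θ i| * ε ≤ 1 / 16) (A : κ → Finset τ) :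
    ∫ x, (∏ i, tiltCoeff (θ i) (A i).card) * ∏ t, ∏ i ∈ finsetFamilyTranspose A t, F i (x t)
        ∂(Measure.pi fun _ : τ => μ₀) ≤
      ∏ t, ((ε ^ (finsetFamilyTranspose A t).card)⁻¹ *
        |∫ a, ∏ i ∈ finsetFamilyTranspose A t, F i a ∂μ₀|) := by
  rw [integral_const_mul, integral_fintype_prod_eq_prod
    (f := fun t a => ∏ i ∈ finsetFamilyTranspose A t, F i a)]
  refine (le_abs_self _).trans ?_
  rw [abs_mul, Finset.abs_prod, Finset.abs_prod, Finset.prod_mul_distrib]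
  refine mul_le_mul_of_nonneg_right ?_ (Finset.prod_nonneg fun _ _ => abs_nonneg _)
  calc ∏ i, |tiltCoeff (θ i) (A i).card| ≤ ∏ i, ∏ _t ∈ A i, ε⁻¹ :=
        Finset.prod_le_prod (fun _ _ => abs_nonneg _) fun i _ => by
          simpa using abs_tiltCoeff_le hε hε' (hθ i) (A i).card
    _ = ∏ t, (ε ^ (finsetFamilyTranspose A t).card)⁻¹ := by
        rw [prod_prod_finsetFamilyTranspose A fun _ _ => ε⁻¹]
        simp only [Finset.prod_const, inv_pow]

theorem integral_prod_tiltWeight_le (hFm : ∀ i, Measurable (F i)) (hF : ∀ i a, |F i a| ≤ ρ)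
    (hε : 0 < ε) (hε' : ε ≤ 1 / 4) (hθ : ∀ i, |θ i| * ε ≤ 1 / 16) :
    ∫ x, ∏ i, tiltWeight (θ i) (F i ∘ x) ∂(Measure.pi fun _ : τ => μ₀) ≤
      (∑ T : Finset κ, (ε ^ T.card)⁻¹ * |∫ a, ∏ i ∈ T, F i a ∂μ₀|) ^ Fintype.card τ := by
  classical
  simp_rw [prod_tiltWeight_eq_sum, Function.comp_apply]
  rw [integral_finsetSum _ fun A _ => integrable_prod_tiltCoeff_mul hFm hF θ A]
  calc _ ≤ ∑ A : κ → Finset τ, ∏ t, ((ε ^ (finsetFamilyTranspose A t).card)⁻¹ *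
          |∫ a, ∏ i ∈ finsetFamilyTranspose A t, F i a ∂μ₀|) :=
        Finset.sum_le_sum fun A _ => integral_prod_tiltCoeff_mul_le hε hε' hθ A
    _ = ∑ T : τ → Finset κ, ∏ t, ((ε ^ (T t).card)⁻¹ * |∫ a, ∏ i ∈ T t, F i a ∂μ₀|) :=
        finsetFamilyTranspose.sum_comp fun T : τ → Finset κ =>
          ∏ t, ((ε ^ (T t).card)⁻¹ * |∫ a, ∏ i ∈ T t, F i a ∂μ₀|)
    _ = _ := by
        rw [← Fintype.piFinset_univ, ← Finset.prod_univ_sum (fun _ : τ => Finset.univ)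
          fun _ T => (ε ^ T.card)⁻¹ * |∫ a, ∏ i ∈ T, F i a ∂μ₀|, Finset.prod_const,
          Finset.card_univ]

end JointExpectation

/-! ### A level-one inequality -/

section LevelOne

variable {X κ : Type*} [MeasurableSpace X] [Fintype κ] {Q : Measure X} [IsProbabilityMeasure Q]

theorem integrable_exp_of_ae_abs_le {f : X → ℝ} {b : ℝ} (hfm : Measurable f)
    (hf : ∀ᵐ x ∂Q, |f x| ≤ b) : Integrable (fun x => Real.exp (f x)) Q := by
  refine Integrable.of_bound hfm.exp.aestronglyMeasurable (Real.exp b) ?_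
  filter_upwards [hf] with x hx
  rw [Real.norm_eq_abs, Real.abs_exp, Real.exp_le_exp]
  exact (le_abs_self _).trans hx

theorem exp_sum_mul_integral_le {Z : κ → X → ℝ} {L : ℝ} (hZm : ∀ i, Measurable (Z i))
    (hZ : ∀ i, ∀ᵐ x ∂Q, |Z i x| ≤ L) (θ : κ → ℝ) :
    Real.exp (∑ i, θ i * ∫ x, Z i x ∂Q) ≤ ∫ x, Real.exp (∑ i, θ i * Z i x) ∂Q := by
  have hθZ_int : ∀ i, Integrable (fun x => θ i * Z i x) Q := fun i =>
    (Integrable.of_bound (hZm i).aestronglyMeasurable L (hZ i)).const_mul _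
  have h_bound : ∀ᵐ x ∂Q, |∑ i, θ i * Z i x| ≤ ∑ i, |θ i| * L := by
    filter_upwards [ae_all_iff.2 hZ] with x hx
    refine (Finset.abs_sum_le_sum_abs _ _).trans (Finset.sum_le_sum fun i _ => ?_)
    rw [abs_mul]
    exact mul_le_mul_of_nonneg_left (hx i) (abs_nonneg _)
  have h_mean : ∫ x, ∑ i, θ i * Z i x ∂Q = ∑ i, θ i * ∫ x, Z i x ∂Q := by
    rw [integral_finsetSum _ fun i _ => hθZ_int i]
    simp_rw [integral_const_mul]
  rw [← h_mean]
  exact convexOn_exp.map_integral_le Real.continuous_exp.continuousOn isClosed_univ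
    (ae_of_all _ fun _ => Set.mem_univ _) (integrable_finsetSum _ fun i _ => hθZ_int i)
    (integrable_exp_of_ae_abs_le (by fun_prop) h_bound)

-- The near-optimal exponent is proportional to the vector of means: `θ i = z i / L ^ 2`.
theorem sum_sq_integral_le_of_integral_exp_le {Z : κ → X → ℝ} {L σ a : ℝ}
    (hZm : ∀ i, Measurable (Z i)) (hZ : ∀ i, ∀ᵐ x ∂Q, |Z i x| ≤ L) (hL : 0 < L)
    (hσ : 2 * σ ^ 2 ≤ L ^ 2)
    (hexp : ∀ θ : κ → ℝ, (∀ i, |θ i| * L ≤ 1) →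
      ∫ x, Real.exp (∑ i, θ i * Z i x) ∂Q ≤ Real.exp (a + ∑ i, (θ i * σ) ^ 2)) :
    ∑ i, (∫ x, Z i x ∂Q) ^ 2 ≤ 2 * L ^ 2 * a := by
  set z : κ → ℝ := fun i => ∫ x, Z i x ∂Q
  set θ : κ → ℝ := fun i => z i / L ^ 2 with hθ
  have hz : ∀ i, |z i| ≤ L := fun i => by
    simpa using norm_integral_le_of_norm_le_const (μ := Q) (f := Z i) (hZ i)
  have hθL : ∀ i, |θ i| * L ≤ 1 := fun i => by
    rw [hθ, abs_div, abs_of_pos (pow_pos hL 2), div_mul_eq_mul_div, div_le_one (by positivity)]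
    nlinarith [hz i]
  have h_le : ∑ i, θ i * z i ≤ a + ∑ i, (θ i * σ) ^ 2 :=
    Real.exp_le_exp.1 ((exp_sum_mul_integral_le hZm hZ θ).trans (hexp θ hθL))
  have h_sq : ∀ i, z i ^ 2 / (2 * L ^ 2) ≤ θ i * z i - (θ i * σ) ^ 2 := fun i => by
    have h_sub : θ i * z i - (θ i * σ) ^ 2 - z i ^ 2 / (2 * L ^ 2) =
        z i ^ 2 * (L ^ 2 - 2 * σ ^ 2) / (2 * L ^ 4) := by
      simp only [hθ]
      field_simp
      ring
    rw [← sub_nonneg, h_sub]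
    have := sub_nonneg.2 hσ
    positivity
  have h_sum := Finset.sum_le_sum fun i (_ : i ∈ Finset.univ) => h_sq i
  rw [← Finset.sum_div, div_le_iff₀ (by positivity), Finset.sum_sub_distrib] at h_sum
  nlinarith [mul_le_mul_of_nonneg_left (sub_le_iff_le_add.2 h_le) (pow_pos hL 2).le]

end LevelOne

/-! ### Relative densities -/

section HasDensityDev

variable {X : Type*} [MeasurableSpace X] {μ ν : Measure X} {f : X → ℝ}

/-- The measure `ν` has density `1 + f` with respect to `μ`, where `f` is a function and not merely
an almost-everywhere class. -/
structure HasDensityDev (μ ν : Measure X) (f : X → ℝ) : Prop where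
  measurable : Measurable f
  integrable : Integrable f μ
  nonneg : ∀ x, 0 ≤ 1 + f x
  eq_withDensity : ν = μ.withDensity fun x => ENNReal.ofReal (1 + f x)

namespace HasDensityDev

theorem absolutelyContinuous (h : HasDensityDev μ ν f) : ν ≪ μ :=
  h.eq_withDensity ▸ withDensity_absolutelyContinuous μ _

variable [IsProbabilityMeasure μ]

theorem integrable_one_add (h : HasDensityDev μ ν f) : Integrable (fun x => 1 + f x) μ :=
  (integrable_const 1).add h.integrable

theorem measureReal_eq_setIntegral (h : HasDensityDev μ ν f) {E : Set X} (hE : MeasurableSet E) :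
    ν.real E = ∫ x in E, (1 + f x) ∂μ := by
  rw [measureReal_def, h.eq_withDensity, withDensity_apply _ hE,
    ← ofReal_integral_eq_lintegral_ofReal h.integrable_one_add.integrableOn (ae_of_all _ h.nonneg),
    ENNReal.toReal_ofReal (integral_nonneg h.nonneg)]

theorem integral_eq_zero [IsProbabilityMeasure ν] (h : HasDensityDev μ ν f) :
    ∫ x, f x ∂μ = 0 := by
  have h_univ := h.measureReal_eq_setIntegral MeasurableSet.univ
  rw [setIntegral_univ, integral_add (integrable_const _) h.integrable] at h_univ
  simpa using h_univ

theorem integral_cond_eq (h : HasDensityDev μ ν f) {E : Set X} (hE : MeasurableSet E)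
    (hpos : 0 < μ.real E) :
    ∫ x, f x ∂(ProbabilityTheory.cond μ E) = ν.real E / μ.real E - 1 := by
  rw [h.measureReal_eq_setIntegral hE, integral_add (integrable_const _) h.integrable.integrableOn,
    ProbabilityTheory.cond, integral_smul_measure, setIntegral_const, ENNReal.toReal_inv,
    ← measureReal_def, smul_eq_mul, smul_eq_mul]
  field_simp
  ring

theorem sq_measureReal_le (h : HasDensityDev μ ν f) (hsq : Integrable (fun x => (1 + f x) ^ 2) μ)
    {A : Set X} (hA : MeasurableSet A) :
    ν.real A ^ 2 ≤ μ.real A * ∫ x, (1 + f x) ^ 2 ∂μ := by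
  rcases measureReal_nonneg.eq_or_lt' (a := μ.real A) with h0 | hpos
  · have h_null : ν A = 0 := h.absolutelyContinuous ((measureReal_eq_zero_iff).1 h0)
    rw [h0, measureReal_def, h_null, ENNReal.toReal_zero, zero_mul, zero_pow two_ne_zero]
  have h_jensen := (even_two.convexOn_pow (𝕜 := ℝ)).map_set_average_le (μ := μ) (t := A)
    (f := fun x => 1 + f x) (by fun_prop) isClosed_univ
    (fun hA0 => hpos.ne' (by simp [measureReal_def, hA0])) (measure_ne_top _ _)
    (ae_of_all _ fun _ => Set.mem_univ _) h.integrable_one_add.integrableOn hsq.integrableOn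
  rw [setAverage_eq, setAverage_eq, ← h.measureReal_eq_setIntegral hA, smul_eq_mul, smul_eq_mul,
    mul_pow, inv_pow, inv_mul_le_iff₀ (by positivity)] at h_jensen
  calc ν.real A ^ 2 ≤ μ.real A ^ 2 * ((μ.real A)⁻¹ * ∫ x in A, (1 + f x) ^ 2 ∂μ) := h_jensen
    _ = μ.real A * ∫ x in A, (1 + f x) ^ 2 ∂μ := by field_simp
    _ ≤ μ.real A * ∫ x, (1 + f x) ^ 2 ∂μ :=
        mul_le_mul_of_nonneg_left (setIntegral_le_integral hsq (ae_of_all _ fun _ => sq_nonneg _))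
          hpos.le

protected theorem pi {τ : Type*} [Fintype τ] [IsProbabilityMeasure ν] (h : HasDensityDev μ ν f) :
    HasDensityDev (Measure.pi fun _ : τ => μ) (Measure.pi fun _ => ν)
      fun x => likelihoodDev (f ∘ x) := by
  have h_prod : ∀ x : τ → X, 1 + likelihoodDev (f ∘ x) = ∏ t, (1 + f (x t)) := fun x =>
    add_sub_cancel _ _
  have h_int : Integrable (fun x : τ → X => ∏ t, (1 + f (x t))) (Measure.pi fun _ => μ) :=
    Integrable.fintype_prod fun _ => h.integrable_one_add
  have h_nonneg : ∀ x : τ → X, 0 ≤ ∏ t, (1 + f (x t)) := fun x =>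
    Finset.prod_nonneg fun t _ => h.nonneg _
  refine ⟨?_, h_int.sub (integrable_const 1), fun x => (h_prod x).symm ▸ h_nonneg x,
    Measure.pi_eq fun s hs => ?_⟩
  · have := h.measurable
    unfold likelihoodDev
    fun_prop
  · simp_rw [h_prod]
    rw [withDensity_apply _ (MeasurableSet.univ_pi hs), Measure.restrict_pi_pi,
      ← ofReal_integral_eq_lintegral_ofReal
        (Integrable.fintype_prod fun _ => h.integrable_one_add.integrableOn)
        (ae_of_all _ h_nonneg),
      integral_fintype_prod_eq_prod (f := fun _ a => 1 + f a),
      ENNReal.ofReal_prod_of_nonneg fun t _ => integral_nonneg h.nonneg]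
    exact Finset.prod_congr rfl fun t _ => by
      rw [← h.measureReal_eq_setIntegral (hs t), ofReal_measureReal]

end HasDensityDev

end HasDensityDev

section TruncatedRatio

variable {Ω : Type*} [MeasurableSpace Ω]

/-- The relative density `dν/dμ - 1`, truncated to `[-ρ, ρ]` so that bounds which hold for it almost
everywhere hold everywhere. -/
noncomputable def truncatedDensityDev (ρ : ℝ) (μ ν : Measure Ω) (a : Ω) : ℝ :=
  max (-ρ) (min ρ ((ν.rnDeriv μ a).toReal - 1))

variable {ρ : ℝ} {μ ν : Measure Ω}

theorem measurable_truncatedDensityDev : Measurable (truncatedDensityDev ρ μ ν) := by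
  have := Measure.measurable_rnDeriv ν μ
  unfold truncatedDensityDev
  fun_prop

theorem abs_truncatedDensityDev_le (hρ : 0 ≤ ρ) (a : Ω) : |truncatedDensityDev ρ μ ν a| ≤ ρ :=
  abs_le.2 ⟨le_max_left _ _, max_le (by linarith) (min_le_left _ _)⟩

theorem absolutelyContinuous_of_measureReal_le [IsFiniteMeasure μ] [IsFiniteMeasure ν] {c : ℝ}
    (h : ∀ E, MeasurableSet E → ν.real E ≤ c * μ.real E) : ν ≪ μ :=
  Measure.AbsolutelyContinuous.mk fun E hE h0 => by
    have hνE := h E hE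
    rw [measureReal_def μ, h0, ENNReal.toReal_zero, mul_zero] at hνE
    exact (measureReal_eq_zero_iff).1 (le_antisymm hνE measureReal_nonneg)

variable [IsFiniteMeasure μ] [IsFiniteMeasure ν]

theorem rnDeriv_ae_eq_truncatedDensityDev
    (hlower : ∀ E, MeasurableSet E → (1 - ρ) * μ.real E ≤ ν.real E)
    (hupper : ∀ E, MeasurableSet E → ν.real E ≤ (1 + ρ) * μ.real E) :
    (fun a => (ν.rnDeriv μ a).toReal - 1) =ᵐ[μ] truncatedDensityDev ρ μ ν := by
  have hac := absolutelyContinuous_of_measureReal_le hupper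
  have h_int : Integrable (fun a => (ν.rnDeriv μ a).toReal) μ := Measure.integrable_toReal_rnDeriv
  have h_upper : (fun a => (ν.rnDeriv μ a).toReal) ≤ᵐ[μ] fun _ => 1 + ρ :=
    ae_le_of_forall_setIntegral_le h_int (integrable_const _) fun s hs _ => by
      rw [Measure.setIntegral_toReal_rnDeriv hac, setIntegral_const, smul_eq_mul, mul_comm]
      exact hupper s hs
  have h_lower : (fun _ => 1 - ρ) ≤ᵐ[μ] fun a => (ν.rnDeriv μ a).toReal :=
    ae_le_of_forall_setIntegral_le (integrable_const _) h_int fun s hs _ => by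
      rw [Measure.setIntegral_toReal_rnDeriv hac, setIntegral_const, smul_eq_mul, mul_comm]
      exact hlower s hs
  filter_upwards [h_upper, h_lower] with a h1 h2
  rw [truncatedDensityDev, min_eq_right (by linarith), max_eq_right (by linarith)]

theorem hasDensityDev_truncatedDensityDev (hρ : 0 ≤ ρ) (hρ' : ρ ≤ 1)
    (hlower : ∀ E, MeasurableSet E → (1 - ρ) * μ.real E ≤ ν.real E)
    (hupper : ∀ E, MeasurableSet E → ν.real E ≤ (1 + ρ) * μ.real E) :
    HasDensityDev μ ν (truncatedDensityDev ρ μ ν) where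
  measurable := measurable_truncatedDensityDev
  integrable := Integrable.of_bound measurable_truncatedDensityDev.aestronglyMeasurable ρ
    (ae_of_all _ (abs_truncatedDensityDev_le hρ))
  nonneg a := by linarith [(abs_le.1 (abs_truncatedDensityDev_le (μ := μ) (ν := ν) hρ a)).1]
  eq_withDensity := by
    conv_lhs => rw [← Measure.withDensity_rnDeriv_eq _ _
      (absolutelyContinuous_of_measureReal_le hupper)]
    refine withDensity_congr_ae ?_
    filter_upwards [rnDeriv_ae_eq_truncatedDensityDev hlower hupper,
      Measure.rnDeriv_lt_top ν μ] with a ha hlt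
    rw [← ha, add_sub_cancel, ENNReal.ofReal_toReal hlt.ne]

end TruncatedRatio

/-! ### Independent samples -/

section Samples

theorem sum_sq_comp_le {X τ : Type*} [Fintype τ] {f : X → ℝ} {ρ : ℝ} (hf : ∀ a, |f a| ≤ ρ)
    (x : τ → X) :
    ∑ t, (f ∘ x) t ^ 2 ≤ Fintype.card τ * ρ ^ 2 := by
  calc ∑ t, f (x t) ^ 2 ≤ ∑ _t : τ, ρ ^ 2 :=
        Finset.sum_le_sum fun t _ => sq_le_sq.2 ((hf _).trans (le_abs_self ρ))
    _ = Fintype.card τ * ρ ^ 2 := by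
        rw [Finset.sum_const, Finset.card_univ, nsmul_eq_mul]

variable {Ω τ : Type*} [MeasurableSpace Ω] [Fintype τ] {μ ν : Measure Ω} [IsProbabilityMeasure μ]
  {f : Ω → ℝ} {ρ : ℝ}

theorem measureReal_le_sum_comp_le_exp (hfm : Measurable f) (hf : ∀ a, |f a| ≤ ρ)
    (hf0 : ∫ a, f a ∂μ = 0) {s : ℝ} (hs : 0 ≤ s) :
    (Measure.pi fun _ : τ => μ).real {x | s ≤ ∑ t, f (x t)} ≤
      Real.exp (-s ^ 2 / (2 * (Fintype.card τ * ρ ^ 2))) := by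
  have h_subgaussian : ∀ t ∈ (Finset.univ : Finset τ), ProbabilityTheory.HasSubgaussianMGF
      (fun x : τ → Ω => f (x t)) ((‖ρ - -ρ‖₊ / 2) ^ 2) (Measure.pi fun _ => μ) := fun t _ =>
    ProbabilityTheory.hasSubgaussianMGF_of_mem_Icc_of_integral_eq_zero
      (hfm.comp (measurable_pi_apply t)).aemeasurable (ae_of_all _ fun x => abs_le.1 (hf (x t)))
      ((integral_comp_eval (μ := fun _ : τ => μ) (i := t) hfm.aestronglyMeasurable).trans hf0)
  have h_param : (((‖ρ - -ρ‖₊ / 2) ^ 2 : NNReal) : ℝ) = ρ ^ 2 := by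
    rw [NNReal.coe_pow, NNReal.coe_div, coe_nnnorm, Real.norm_eq_abs, div_pow, sq_abs,
      NNReal.coe_ofNat]
    ring
  refine (ProbabilityTheory.HasSubgaussianMGF.measure_sum_ge_le_of_iIndepFun
    (ProbabilityTheory.iIndepFun_pi (μ := fun _ : τ => μ) (X := fun _ => f)
      fun _ => hfm.aemeasurable) h_subgaussian hs).trans_eq ?_
  rw [Finset.sum_const, Finset.card_univ, NNReal.coe_nsmul, h_param, nsmul_eq_mul]

theorem measureReal_lt_abs_likelihoodDev_le (hfm : Measurable f) (hf : ∀ a, |f a| ≤ ρ)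
    (hf0 : ∫ a, f a ∂μ = 0) (hρ : ρ ≤ 1 / 2) {s : ℝ} (hs : 2 * (Fintype.card τ * ρ ^ 2) ≤ s)
    (hs1 : s ≤ 1) :
    (Measure.pi fun _ : τ => μ).real {x | 2 * s < |likelihoodDev (f ∘ x)|} ≤
      2 * Real.exp (-s ^ 2 / (2 * (Fintype.card τ * ρ ^ 2))) := by
  have hs0 : 0 ≤ s := le_trans (by positivity) hs
  have h_upper := measureReal_le_sum_comp_le_exp (τ := τ) hfm hf hf0 hs0
  have h_lower := measureReal_le_sum_comp_le_exp (τ := τ) (μ := μ) hfm.neg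
    (fun a => (abs_neg (f a)).trans_le (hf a)) (by simp [integral_neg, hf0]) hs0
  have h_sub : {x : τ → Ω | 2 * s < |likelihoodDev (f ∘ x)|} ⊆
      {x | s ≤ ∑ t, f (x t)} ∪ {x | s ≤ ∑ t, (-f) (x t)} := by
    intro x hx
    by_contra h_not
    simp only [Set.mem_union, Set.mem_ofPred_eq, not_or, not_le, Pi.neg_apply,
      Finset.sum_neg_distrib] at h_not hx
    refine hx.not_ge (abs_likelihoodDev_le (fun t => (hf (x t)).trans hρ) ?_ hs1 ?_)
    · linarith [sum_sq_comp_le hf x]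
    · exact abs_le.2 ⟨by simp only [Function.comp_apply]; linarith, h_not.1.le⟩
  linarith [(measureReal_mono h_sub).trans
    (measureReal_union_le (μ := Measure.pi fun _ : τ => μ) _ _)]

theorem integrable_sq_one_add (hfm : Measurable f) (hf : ∀ a, |f a| ≤ ρ) :
    Integrable (fun a => (1 + f a) ^ 2) μ :=
  Integrable.of_bound (by fun_prop) ((1 + ρ) ^ 2) (ae_of_all _ fun a => by
    rw [Real.norm_eq_abs, abs_pow]
    exact pow_le_pow_left₀ (abs_nonneg _)
      ((abs_add_le _ _).trans (by rw [abs_one]; linarith [hf a])) 2)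

theorem integral_sq_one_add_le (hfm : Measurable f) (hf : ∀ a, |f a| ≤ ρ)
    (hf0 : ∫ a, f a ∂μ = 0) : ∫ a, (1 + f a) ^ 2 ∂μ ≤ 1 + ρ ^ 2 := by
  have hf_int : Integrable f μ :=
    Integrable.of_bound hfm.aestronglyMeasurable ρ (ae_of_all _ hf)
  have h_bound_int : Integrable (fun a => 1 + ρ ^ 2 + 2 * f a) μ :=
    (integrable_const _).add (hf_int.const_mul 2)
  calc ∫ a, (1 + f a) ^ 2 ∂μ ≤ ∫ a, (1 + ρ ^ 2 + 2 * f a) ∂μ :=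
        integral_mono (integrable_sq_one_add hfm hf) h_bound_int fun a => by
          have := sq_le_sq.2 ((hf a).trans (le_abs_self ρ))
          simp only
          linarith
    _ = 1 + ρ ^ 2 := by
        rw [integral_add (integrable_const _) (hf_int.const_mul 2), integral_const_mul, hf0]
        simp

theorem one_add_likelihoodDev_sq_eq_prod (g : τ → ℝ) :
    (1 + likelihoodDev g) ^ 2 = ∏ t, (1 + g t) ^ 2 := by
  rw [likelihoodDev, add_sub_cancel, Finset.prod_pow]

theorem integrable_sq_one_add_likelihoodDev (hfm : Measurable f) (hf : ∀ a, |f a| ≤ ρ) :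
    Integrable (fun x => (1 + likelihoodDev (f ∘ x)) ^ 2) (Measure.pi fun _ : τ => μ) := by
  simp_rw [one_add_likelihoodDev_sq_eq_prod]
  exact Integrable.fintype_prod (f := fun _ a => (1 + f a) ^ 2) fun _ =>
    integrable_sq_one_add hfm hf

theorem integral_sq_one_add_likelihoodDev_le (hfm : Measurable f) (hf : ∀ a, |f a| ≤ ρ)
    (hf0 : ∫ a, f a ∂μ = 0) :
    ∫ x, (1 + likelihoodDev (f ∘ x)) ^ 2 ∂(Measure.pi fun _ : τ => μ) ≤
      Real.exp (Fintype.card τ * ρ ^ 2) := by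
  simp_rw [one_add_likelihoodDev_sq_eq_prod, Function.comp_apply]
  rw [integral_fintype_prod_eq_prod (f := fun _ a => (1 + f a) ^ 2), Finset.prod_const,
    Finset.card_univ, Real.exp_nat_mul]
  refine pow_le_pow_left₀ (integral_nonneg fun a => sq_nonneg _) ?_ _
  linarith [integral_sq_one_add_le hfm hf hf0, Real.add_one_le_exp (ρ ^ 2)]

theorem HasDensityDev.measureReal_pi_le [IsProbabilityMeasure ν] (h : HasDensityDev μ ν f)
    (hf : ∀ a, |f a| ≤ ρ) (hρ : Fintype.card τ * ρ ^ 2 ≤ 1 / 4) {δ : ℝ} (hδ : 0 ≤ δ)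
    {A : Set (τ → Ω)} (hA : MeasurableSet A)
    (hμA : (Measure.pi fun _ : τ => μ).real A ≤ δ ^ 2 / 2) :
    (Measure.pi fun _ : τ => ν).real A ≤ δ := by
  have h_exp : Real.exp (1 / 4) ≤ 2 := by
    linarith [(abs_le.1 (Real.abs_exp_sub_one_sub_id_le (x := 1 / 4) (by norm_num))).2]
  have h_moment := (integral_sq_one_add_likelihoodDev_le (τ := τ) h.measurable hf
    h.integral_eq_zero).trans ((Real.exp_le_exp.2 hρ).trans h_exp)
  refine le_of_sq_le_sq ?_ hδ
  calc (Measure.pi fun _ : τ => ν).real A ^ 2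
      ≤ (Measure.pi fun _ : τ => μ).real A *
          ∫ x, (1 + likelihoodDev (f ∘ x)) ^ 2 ∂(Measure.pi fun _ : τ => μ) :=
        (h.pi (τ := τ)).sq_measureReal_le (integrable_sq_one_add_likelihoodDev h.measurable hf) hA
    _ ≤ δ ^ 2 / 2 * 2 := mul_le_mul hμA h_moment
        (integral_nonneg fun _ => sq_nonneg _) (by positivity)
    _ = δ ^ 2 := by ring

end Samples

section SampleLevelOne

variable {Ω κ τ : Type*} [MeasurableSpace Ω] [Fintype κ] [Fintype τ] {μ₀ : Measure Ω}
  [IsProbabilityMeasure μ₀] {F : κ → Ω → ℝ} {ρ ε L : ℝ}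

theorem integral_prod_tiltWeight_le_exp_one (hFm : ∀ i, Measurable (F i))
    (hF : ∀ i a, |F i a| ≤ ρ) (hε : 0 < ε) (hε' : ε ≤ 1 / 4)
    (hcorr : ∑ T : Finset κ, (ε ^ T.card)⁻¹ * |∫ a, ∏ i ∈ T, F i a ∂μ₀| ≤
      1 + (Fintype.card τ : ℝ)⁻¹)
    {θ : κ → ℝ} (hθ : ∀ i, |θ i| * ε ≤ 1 / 16) :
    ∫ x, ∏ i, tiltWeight (θ i) (F i ∘ x) ∂(Measure.pi fun _ : τ => μ₀) ≤ Real.exp 1 :=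
  calc _ ≤ (∑ T : Finset κ, (ε ^ T.card)⁻¹ * |∫ a, ∏ i ∈ T, F i a ∂μ₀|) ^ Fintype.card τ :=
        integral_prod_tiltWeight_le hFm hF hε hε' hθ
    _ ≤ (1 + (Fintype.card τ : ℝ)⁻¹) ^ Fintype.card τ :=
        pow_le_pow_left₀ (Finset.sum_nonneg fun _ _ => by positivity) hcorr _
    _ ≤ Real.exp 1 := Real.one_add_inv_pow_le_exp

theorem integral_exp_sum_likelihoodDev_cond_le (hFm : ∀ i, Measurable (F i))
    (hF : ∀ i a, |F i a| ≤ ρ) (hε : 0 < ε) (hε' : ε ≤ 1 / 4) (hρ : Fintype.card τ * ρ ^ 2 = ε ^ 2)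
    (hcorr : ∑ T : Finset κ, (ε ^ T.card)⁻¹ * |∫ a, ∏ i ∈ T, F i a ∂μ₀| ≤
      1 + (Fintype.card τ : ℝ)⁻¹)
    {A : Set (τ → Ω)} (hA : MeasurableSet A) (hpos : 0 < (Measure.pi fun _ => μ₀).real A)
    {θ : κ → ℝ} (hθ : ∀ i, |θ i| * ε ≤ 1 / 16)
    (hθA : ∀ i, ∀ x ∈ A, |θ i * likelihoodDev (F i ∘ x)| ≤ 1) :
    ∫ x, Real.exp (∑ i, θ i * likelihoodDev (F i ∘ x))
        ∂(ProbabilityTheory.cond (Measure.pi fun _ => μ₀) A) ≤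
      Real.exp (1 - Real.log ((Measure.pi fun _ => μ₀).real A) + ∑ i, 96 * (θ i * ε) ^ 2) := by
  set M₀ : Measure (τ → Ω) := Measure.pi fun _ => μ₀
  set S := ∑ i, 96 * (θ i * ε) ^ 2
  have hg : ∀ i (x : τ → Ω), ∑ t, (F i ∘ x) t ^ 2 ≤ ε ^ 2 := fun i x =>
    hρ ▸ sum_sq_comp_le (hF i) x
  have h_weight_int : Integrable (fun x => Real.exp S * ∏ i, tiltWeight (θ i) (F i ∘ x)) M₀ :=
    (integrable_prod_tiltWeight hFm hF θ).const_mul _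
  have h_weight_nonneg : ∀ x : τ → Ω, 0 ≤ Real.exp S * ∏ i, tiltWeight (θ i) (F i ∘ x) := fun x =>
    mul_nonneg (Real.exp_pos _).le
      (Finset.prod_nonneg fun i _ => tiltWeight_nonneg hε.le hε' (hg i x) (hθ i))
  have h_le_weight : ∀ x ∈ A, Real.exp (∑ i, θ i * likelihoodDev (F i ∘ x)) ≤
      Real.exp S * ∏ i, tiltWeight (θ i) (F i ∘ x) := fun x hx => by
    rw [← sub_add_cancel (∑ i, θ i * likelihoodDev (F i ∘ x)) S, add_comm, Real.exp_add,
      ← Finset.sum_sub_distrib]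
    refine mul_le_mul_of_nonneg_left ?_ (Real.exp_pos _).le
    rw [Real.exp_sum]
    exact Finset.prod_le_prod (fun _ _ => (Real.exp_pos _).le) fun i _ =>
      exp_le_tiltWeight hε.le hε' (hg i x) (hθ i) (hθA i x hx)
  have h_setIntegral : ∫ x in A, Real.exp (∑ i, θ i * likelihoodDev (F i ∘ x)) ∂M₀ ≤
      Real.exp S * Real.exp 1 := by
    calc _ ≤ ∫ x in A, Real.exp S * ∏ i, tiltWeight (θ i) (F i ∘ x) ∂M₀ :=
          integral_mono_of_nonneg (ae_of_all _ fun _ => (Real.exp_pos _).le)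
            h_weight_int.integrableOn (ae_restrict_of_forall_mem hA h_le_weight)
      _ ≤ ∫ x, Real.exp S * ∏ i, tiltWeight (θ i) (F i ∘ x) ∂M₀ :=
          setIntegral_le_integral h_weight_int (ae_of_all _ h_weight_nonneg)
      _ ≤ Real.exp S * Real.exp 1 := by
          rw [integral_const_mul]
          exact mul_le_mul_of_nonneg_left
            (integral_prod_tiltWeight_le_exp_one hFm hF hε hε' hcorr hθ) (Real.exp_pos _).le
  rw [ProbabilityTheory.cond, integral_smul_measure, ENNReal.toReal_inv, ← measureReal_def,
    smul_eq_mul, inv_mul_le_iff₀ hpos, Real.exp_add, Real.exp_sub, Real.exp_log hpos]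
  exact h_setIntegral.trans_eq (by field_simp)

theorem sum_sq_integral_likelihoodDev_cond_le (hFm : ∀ i, Measurable (F i))
    (hF : ∀ i a, |F i a| ≤ ρ) (hε : 0 < ε) (hε' : ε ≤ 1 / 4) (hρ : Fintype.card τ * ρ ^ 2 = ε ^ 2)
    (hcorr : ∑ T : Finset κ, (ε ^ T.card)⁻¹ * |∫ a, ∏ i ∈ T, F i a ∂μ₀| ≤
      1 + (Fintype.card τ : ℝ)⁻¹)
    (hL : 16 * ε ≤ L) {A : Set (τ → Ω)} (hA : MeasurableSet A)
    (hpos : 0 < (Measure.pi fun _ => μ₀).real A)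
    (hAL : ∀ i, ∀ x ∈ A, |likelihoodDev (F i ∘ x)| ≤ L) :
    ∑ i, (∫ x, likelihoodDev (F i ∘ x)
        ∂(ProbabilityTheory.cond (Measure.pi fun _ => μ₀) A)) ^ 2 ≤
      2 * L ^ 2 * (1 - Real.log ((Measure.pi fun _ => μ₀).real A)) := by
  have hL0 : 0 < L := by linarith
  have : IsProbabilityMeasure (ProbabilityTheory.cond (Measure.pi fun _ : τ => μ₀) A) :=
    ProbabilityTheory.cond_isProbabilityMeasure fun h0 =>
      hpos.ne' (by rw [measureReal_def, h0]; rfl)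
  refine sum_sq_integral_le_of_integral_exp_le (σ := 10 * ε) (fun i => ?_) (fun i => ?_) hL0
    (by nlinarith) fun θ hθ => ?_
  · have := hFm i
    unfold likelihoodDev
    fun_prop
  · exact (ProbabilityTheory.ae_cond_mem hA).mono fun x hx => hAL i x hx
  · refine (integral_exp_sum_likelihoodDev_cond_le hFm hF hε hε' hρ hcorr hA hpos (θ := θ)
      (fun i => ?_) fun i x hx => ?_).trans (Real.exp_le_exp.2 (add_le_add_right
        (Finset.sum_le_sum fun i _ => ?_) _))
    · nlinarith [hθ i, mul_le_mul_of_nonneg_left hL (abs_nonneg (θ i))]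
    · rw [abs_mul]
      exact (mul_le_mul_of_nonneg_left (hAL i x hx) (abs_nonneg _)).trans (hθ i)
    · nlinarith [sq_nonneg (θ i * ε)]

end SampleLevelOne

/-! ### Conditioned families -/

/-- A family `N i` that is close to `N₀` in the sense of a level-one inequality: no event determines
the index `i` much better than its `N₀`-surprisal allows. -/
structure HasLevelOneBound {X κ : Type*} [MeasurableSpace X] [Fintype κ] (N₀ : Measure X)
    (N : κ → Measure X) (K : ℝ) : Prop where
  absolutelyContinuous : ∀ i, N i ≪ N₀
  half_le : ∀ i E, MeasurableSet E → 1 / 2 * N₀.real E ≤ (N i).real E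
  sum_sq_le : ∀ E, MeasurableSet E → 0 < N₀.real E →
    ∑ i, ((N i).real E / N₀.real E - 1) ^ 2 ≤ K * (3 - Real.log (N₀.real E))

section Conditioning

variable {X κ : Type*} [MeasurableSpace X] [Fintype κ] {M₀ N₀ ν : Measure X}
  {M N : κ → Measure X} {G E : Set X} {K L δ : ℝ}

theorem HasLevelOneBound.nonneg [IsProbabilityMeasure N₀] (h : HasLevelOneBound N₀ N K) :
    0 ≤ K := by
  have h_univ := h.sum_sq_le Set.univ MeasurableSet.univ (by simp)
  rw [probReal_univ, Real.log_one, sub_zero] at h_univ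
  linarith [Finset.sum_nonneg fun i (_ : i ∈ Finset.univ) =>
    sq_nonneg ((N i).real Set.univ / 1 - 1)]

theorem HasDensityDev.one_sub_mul_measureReal_le [IsProbabilityMeasure M₀] {f : X → ℝ}
    (h : HasDensityDev M₀ ν f) (hE : MeasurableSet E) (hf : ∀ x ∈ E, -L ≤ f x) :
    (1 - L) * M₀.real E ≤ ν.real E := by
  rw [h.measureReal_eq_setIntegral hE, mul_comm, ← smul_eq_mul, ← setIntegral_const]
  exact setIntegral_mono_on (integrable_const _) h.integrable_one_add.integrableOn hE
    fun x hx => by linarith [hf x hx]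

theorem measureReal_cond_apply (hG : MeasurableSet G) (ν : Measure X) (E : Set X) :
    (ProbabilityTheory.cond ν G).real E = (ν.real G)⁻¹ * ν.real (G ∩ E) := by
  rw [measureReal_def, ProbabilityTheory.cond_apply hG, ENNReal.toReal_mul, ENNReal.toReal_inv]
  rfl

theorem cond_absolutelyContinuous_cond (hν : ν ≪ M₀) (hG : M₀ G ≠ ∞) :
    ProbabilityTheory.cond ν G ≪ ProbabilityTheory.cond M₀ G :=
  Measure.smul_absolutelyContinuous.trans ((hν.restrict G).trans
    (Measure.absolutelyContinuous_smul (ENNReal.inv_ne_zero.2 hG)))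

theorem sq_div_mul_one_add_sub_one_le {a b : ℝ} (hδ : δ ≤ 1 / 4) (ha : 1 - δ ≤ a) (ha1 : a ≤ 1)
    (hb : 1 - δ ≤ b) (hb1 : b ≤ 1) (z : ℝ) :
    (a / b * (1 + z) - 1) ^ 2 ≤ 4 * z ^ 2 + 8 * δ ^ 2 := by
  have hb0 : 0 < b := by linarith
  set r := a / b
  have h_lower : 1 - δ ≤ r := by
    rw [le_div_iff₀ hb0]
    nlinarith
  have h_upper : r ≤ 1 + 2 * δ := by
    rw [div_le_iff₀ hb0]
    nlinarith
  have h_sq : r ^ 2 ≤ 2 := by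
    have : r ≤ 4 / 3 := by
      rw [div_le_iff₀ hb0]
      linarith
    nlinarith
  have h_sq_sub : (r - 1) ^ 2 ≤ 4 * δ ^ 2 := by nlinarith
  calc (r * (1 + z) - 1) ^ 2 ≤ 2 * (r ^ 2 * z ^ 2) + 2 * (r - 1) ^ 2 := by
        nlinarith [sq_nonneg (r * z - (r - 1))]
    _ ≤ 2 * (2 * z ^ 2) + 2 * (4 * δ ^ 2) := by gcongr
    _ = 4 * z ^ 2 + 8 * δ ^ 2 := by ring

variable [IsProbabilityMeasure M₀] {Z : κ → X → ℝ}

theorem HasDensityDev.half_mul_measureReal_cond_le [IsProbabilityMeasure ν] {f : X → ℝ}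
    (h : HasDensityDev M₀ ν f) (hG : MeasurableSet G) (hf : ∀ x ∈ G, -(1 / 4) ≤ f x)
    (hG₀ : 3 / 4 ≤ M₀.real G) (hνG : 0 < ν.real G) (hE : MeasurableSet E) :
    1 / 2 * (ProbabilityTheory.cond M₀ G).real E ≤ (ProbabilityTheory.cond ν G).real E := by
  rw [measureReal_cond_apply hG, measureReal_cond_apply hG]
  have h_inv : 1 / 2 * (M₀.real G)⁻¹ ≤ 3 / 4 := by
    rw [← div_eq_mul_inv, div_le_iff₀ (by linarith)]
    linarith
  calc 1 / 2 * ((M₀.real G)⁻¹ * M₀.real (G ∩ E)) ≤ 3 / 4 * M₀.real (G ∩ E) := by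
        rw [← mul_assoc]
        exact mul_le_mul_of_nonneg_right h_inv measureReal_nonneg
    _ ≤ ν.real (G ∩ E) := by
        linarith [h.one_sub_mul_measureReal_le (hG.inter hE) fun x hx => hf x hx.1]
    _ ≤ (ν.real G)⁻¹ * ν.real (G ∩ E) :=
        le_mul_of_one_le_left measureReal_nonneg ((one_le_inv₀ hνG).2 measureReal_le_one)

theorem sum_sq_measureReal_cond_div_le [∀ i, IsProbabilityMeasure (M i)]
    (hZ : ∀ i, HasDensityDev M₀ (M i) (Z i)) (hδ : δ ≤ 1 / 4) (hG₀ : 1 - δ ≤ M₀.real G)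
    (hGi : ∀ i, 1 - δ ≤ (M i).real G) (hG : MeasurableSet G) (hE : MeasurableSet E)
    (hpos : 0 < M₀.real (G ∩ E)) :
    ∑ i, ((ProbabilityTheory.cond (M i) G).real E / (ProbabilityTheory.cond M₀ G).real E - 1) ^ 2 ≤
      4 * ∑ i, (∫ x, Z i x ∂(ProbabilityTheory.cond M₀ (G ∩ E))) ^ 2
        + 8 * (Fintype.card κ * δ ^ 2) := by
  have h_ratio : ∀ i, (ProbabilityTheory.cond (M i) G).real E /
      (ProbabilityTheory.cond M₀ G).real E = M₀.real G / (M i).real G *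
        (1 + ∫ x, Z i x ∂(ProbabilityTheory.cond M₀ (G ∩ E))) := fun i => by
    have hMG : (M i).real G ≠ 0 := by linarith [hGi i]
    rw [(hZ i).integral_cond_eq (hG.inter hE) hpos, measureReal_cond_apply hG,
      measureReal_cond_apply hG]
    field_simp
    ring
  calc _ ≤ ∑ i, (4 * (∫ x, Z i x ∂(ProbabilityTheory.cond M₀ (G ∩ E))) ^ 2 + 8 * δ ^ 2) :=
        Finset.sum_le_sum fun i _ => by
          rw [h_ratio]
          exact sq_div_mul_one_add_sub_one_le hδ hG₀ measureReal_le_one (hGi i) measureReal_le_one _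
    _ = _ := by
        rw [Finset.sum_add_distrib, ← Finset.mul_sum, Finset.sum_const, Finset.card_univ,
          nsmul_eq_mul]
        ring

theorem hasLevelOneBound_cond [∀ i, IsProbabilityMeasure (M i)]
    (hZ : ∀ i, HasDensityDev M₀ (M i) (Z i)) (hG : MeasurableSet G)
    (hZG : ∀ i, ∀ x ∈ G, |Z i x| ≤ L) (hL : L ≤ 1 / 4) (hδ : δ ≤ 1 / 4)
    (hδL : Fintype.card κ * δ ^ 2 ≤ L ^ 2) (hG₀ : 1 - δ ≤ M₀.real G)
    (hGi : ∀ i, 1 - δ ≤ (M i).real G)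
    (hlevel : ∀ A ⊆ G, MeasurableSet A → 0 < M₀.real A →
      ∑ i, (∫ x, Z i x ∂(ProbabilityTheory.cond M₀ A)) ^ 2 ≤
        2 * L ^ 2 * (1 - Real.log (M₀.real A))) :
    HasLevelOneBound (ProbabilityTheory.cond M₀ G) (fun i => ProbabilityTheory.cond (M i) G)
      (8 * L ^ 2) where
  absolutelyContinuous i :=
    cond_absolutelyContinuous_cond (hZ i).absolutelyContinuous (measure_ne_top _ _)
  half_le i E hE := (hZ i).half_mul_measureReal_cond_le hG
    (fun x hx => by linarith [(abs_le.1 (hZG i x hx)).1]) (by linarith) (by linarith [hGi i]) hE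
  sum_sq_le E hE hpos := by
    have hG₀_pos : 0 < M₀.real G := by linarith
    have h_cond := measureReal_cond_apply hG M₀ E
    have hGE_pos : 0 < M₀.real (G ∩ E) := by
      rw [h_cond] at hpos
      exact pos_of_mul_pos_right hpos (inv_nonneg.2 hG₀_pos.le)
    have h_log_G : -1 ≤ Real.log (M₀.real G) := by
      have := Real.one_sub_inv_le_log_of_pos hG₀_pos
      have : (M₀.real G)⁻¹ ≤ 2 := by
        rw [inv_le_comm₀ hG₀_pos two_pos]
        linarith
      linarith
    have h_log : Real.log ((ProbabilityTheory.cond M₀ G).real E) =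
        Real.log (M₀.real (G ∩ E)) - Real.log (M₀.real G) := by
      rw [h_cond, ← div_eq_inv_mul, Real.log_div hGE_pos.ne' hG₀_pos.ne']
    have h_sum := sum_sq_measureReal_cond_div_le hZ hδ hG₀ hGi hG hE hGE_pos
    have h_level := hlevel (G ∩ E) Set.inter_subset_left (hG.inter hE) hGE_pos
    rw [h_log]
    nlinarith [mul_le_mul_of_nonneg_left h_log_G (sq_nonneg L)]

end Conditioning

section SampleConditioning

theorem measurableSet_forall_abs_likelihoodDev_le {Ω κ τ : Type*} [MeasurableSpace Ω]
    [Countable κ] [Fintype τ] {F : κ → Ω → ℝ} (hFm : ∀ i, Measurable (F i)) (L : ℝ) :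
    MeasurableSet {x : τ → Ω | ∀ i, |likelihoodDev (F i ∘ x)| ≤ L} := by
  rw [Set.ofPred_forall]
  refine MeasurableSet.iInter fun i => measurableSet_le (Measurable.abs ?_) measurable_const
  have := hFm i
  unfold likelihoodDev
  fun_prop

variable {Ω κ τ : Type*} [MeasurableSpace Ω] [Fintype κ] [Fintype τ] {μ₀ : Measure Ω}
  {μ : κ → Measure Ω} [IsProbabilityMeasure μ₀] [∀ i, IsProbabilityMeasure (μ i)]
  {F : κ → Ω → ℝ} {ρ ε L δ : ℝ}

theorem measureReal_compl_forall_abs_likelihoodDev_le (hFm : ∀ i, Measurable (F i))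
    (hF : ∀ i a, |F i a| ≤ ρ) (hF0 : ∀ i, ∫ a, F i a ∂μ₀ = 0) (hρ : ρ ≤ 1 / 2)
    (hε : Fintype.card τ * ρ ^ 2 = ε ^ 2) (hL : 4 * ε ^ 2 ≤ L) (hL2 : L ≤ 2) :
    (Measure.pi fun _ : τ => μ₀).real {x | ∀ i, |likelihoodDev (F i ∘ x)| ≤ L}ᶜ ≤
      2 * Fintype.card κ * Real.exp (-L ^ 2 / (8 * ε ^ 2)) := by
  have h_compl : {x : τ → Ω | ∀ i, |likelihoodDev (F i ∘ x)| ≤ L}ᶜ =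
      ⋃ i ∈ (Finset.univ : Finset κ), {x | 2 * (L / 2) < |likelihoodDev (F i ∘ x)|} := by
    ext x
    simp [mul_div_cancel₀]
  rw [h_compl]
  refine (measureReal_biUnion_finset_le _ _).trans ?_
  calc _ ≤ ∑ _i : κ, 2 * Real.exp (-(L / 2) ^ 2 / (2 * ε ^ 2)) := Finset.sum_le_sum fun i _ => by
        rw [← hε]
        exact measureReal_lt_abs_likelihoodDev_le (hFm i) (hF i) (hF0 i) hρ
          (by rw [hε]; linarith) (by linarith)
    _ = 2 * Fintype.card κ * Real.exp (-L ^ 2 / (8 * ε ^ 2)) := by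
        rw [Finset.sum_const, Finset.card_univ, nsmul_eq_mul,
          show -(L / 2) ^ 2 / (2 * ε ^ 2) = -L ^ 2 / (8 * ε ^ 2) by ring]
        ring

theorem one_sub_le_measureReal_of_compl_le {X : Type*} [MeasurableSpace X] {ν : Measure X}
    [IsProbabilityMeasure ν] {G : Set X} (hG : MeasurableSet G) (h : ν.real Gᶜ ≤ δ) :
    1 - δ ≤ ν.real G := by
  rw [probReal_compl_eq_one_sub hG] at h
  linarith

theorem hasLevelOneBound_cond_pi (hF : ∀ i a, |F i a| ≤ ρ)
    (hμ : ∀ i, HasDensityDev μ₀ (μ i) (F i)) (hρ : ρ ≤ 1 / 2) (hε0 : 0 < ε)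
    (hε : Fintype.card τ * ρ ^ 2 = ε ^ 2)
    (hcorr : ∑ T : Finset κ, (ε ^ T.card)⁻¹ * |∫ a, ∏ i ∈ T, F i a ∂μ₀| ≤
      1 + (Fintype.card τ : ℝ)⁻¹)
    (hL : 16 * ε ≤ L) (hL' : L ≤ 1 / 4) (hδ0 : 0 ≤ δ) (hδ : δ ≤ 1 / 4)
    (hδL : Fintype.card κ * δ ^ 2 ≤ L ^ 2)
    (htail : 2 * Fintype.card κ * Real.exp (-L ^ 2 / (8 * ε ^ 2)) ≤ δ ^ 2 / 2) :
    ∃ G : Set (τ → Ω), MeasurableSet G ∧ 1 - δ ≤ (Measure.pi fun _ => μ₀).real G ∧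
      (∀ i, 1 - δ ≤ (Measure.pi fun _ => μ i).real G) ∧
      HasLevelOneBound (ProbabilityTheory.cond (Measure.pi fun _ => μ₀) G)
        (fun i => ProbabilityTheory.cond (Measure.pi fun _ => μ i) G) (8 * L ^ 2) := by
  have hFm : ∀ i, Measurable (F i) := fun i => (hμ i).measurable
  set G : Set (τ → Ω) := {x | ∀ i, |likelihoodDev (F i ∘ x)| ≤ L}
  have hG : MeasurableSet G := measurableSet_forall_abs_likelihoodDev_le hFm L
  have hGc : (Measure.pi fun _ => μ₀).real Gᶜ ≤ δ ^ 2 / 2 :=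
    (measureReal_compl_forall_abs_likelihoodDev_le hFm hF (fun i => (hμ i).integral_eq_zero) hρ hε
      (by nlinarith) (by linarith)).trans htail
  have hG₀ : 1 - δ ≤ (Measure.pi fun _ => μ₀).real G :=
    one_sub_le_measureReal_of_compl_le hG (hGc.trans (by nlinarith))
  have hGi : ∀ i, 1 - δ ≤ (Measure.pi fun _ => μ i).real G := fun i =>
    one_sub_le_measureReal_of_compl_le hG
      ((hμ i).measureReal_pi_le (hF i) (by rw [hε]; nlinarith) hδ0 hG.compl hGc)
  exact ⟨G, hG, hG₀, hGi, hasLevelOneBound_cond (fun i => (hμ i).pi) hG (fun i x hx => hx i) hL' hδ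
    hδL hG₀ hGi fun A hAG hA hpos => sum_sq_integral_likelihoodDev_cond_le hFm hF hε0
      (by linarith) hε hcorr hL hA hpos fun i x hx => hAG hx i⟩

end SampleConditioning

/-! ### Hellinger affinity and entropy -/

section Affinity

variable {Λ : Type*} [Fintype Λ]

/-- The Hellinger affinity (Bhattacharyya coefficient) of two weight vectors. -/
noncomputable def affinity (p q : Λ → ℝ) : ℝ :=
  ∑ l, √(p l * q l)

theorem two_mul_sqrt_mul_le_add {x y : ℝ} (hx : 0 ≤ x) (hy : 0 ≤ y) : 2 * √(x * y) ≤ x + y := by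
  rw [Real.sqrt_mul hx]
  nlinarith [two_mul_le_add_sq √x √y, Real.sq_sqrt hx, Real.sq_sqrt hy]

theorem affinity_le_one {p q : Λ → ℝ} (hp : ∀ l, 0 ≤ p l) (hq : ∀ l, 0 ≤ q l)
    (hp1 : ∑ l, p l = 1) (hq1 : ∑ l, q l = 1) : affinity p q ≤ 1 := by
  have h_sum := Finset.sum_le_sum fun l (_ : l ∈ Finset.univ) =>
    two_mul_sqrt_mul_le_add (hp l) (hq l)
  rw [← Finset.mul_sum, Finset.sum_add_distrib, hp1, hq1] at h_sum
  rw [affinity]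
  linarith

theorem sub_le_mul_sub_sqrt_add {a x y : ℝ} (ha : 0 < a) (hx : 0 ≤ x) (hy : 0 ≤ y) :
    y - x ≤ a * (x + y - 2 * √(x * y)) + (x + y + 2 * √(x * y)) / (4 * a) := by
  rw [Real.sqrt_mul hx]
  have h_sq : 0 ≤ (2 * a * (√y - √x) - (√y + √x)) ^ 2 / (4 * a) := by positivity
  have h_expand : (2 * a * (√y - √x) - (√y + √x)) ^ 2 / (4 * a) =
      a * (√x ^ 2 + √y ^ 2 - 2 * (√x * √y)) + (√x ^ 2 + √y ^ 2 + 2 * (√x * √y)) / (4 * a) -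
        (√y ^ 2 - √x ^ 2) := by
    field_simp
    ring
  rw [h_expand, Real.sq_sqrt hx, Real.sq_sqrt hy] at h_sq
  linarith

theorem sum_sub_sum_le_of_affinity {p q : Λ → ℝ} (hp : ∀ l, 0 ≤ p l) (hq : ∀ l, 0 ≤ q l)
    (hp1 : ∑ l, p l = 1) (hq1 : ∑ l, q l = 1) {a : ℝ} (ha : 0 < a) (A : Finset Λ) :
    ∑ l ∈ A, q l - ∑ l ∈ A, p l ≤ 2 * a * (1 - affinity p q) + 1 / a := by
  set b : Λ → ℝ := fun l => a * (p l + q l - 2 * √(p l * q l)) +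
    (p l + q l + 2 * √(p l * q l)) / (4 * a) with hb
  have hb_nonneg : ∀ l, 0 ≤ b l := fun l => by
    have := hp l
    have := hq l
    have := sub_nonneg.2 (two_mul_sqrt_mul_le_add (hp l) (hq l))
    positivity
  rw [← Finset.sum_sub_distrib]
  calc ∑ l ∈ A, (q l - p l) ≤ ∑ l ∈ A, b l :=
        Finset.sum_le_sum fun l _ => sub_le_mul_sub_sqrt_add ha (hp l) (hq l)
    _ ≤ ∑ l, b l :=
        Finset.sum_le_sum_of_subset_of_nonneg (Finset.subset_univ _) fun l _ _ => hb_nonneg l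
    _ = 2 * a * (1 - affinity p q) + (2 + 2 * affinity p q) / (4 * a) := by
        simp only [hb, affinity, Finset.sum_add_distrib, Finset.sum_sub_distrib, ← Finset.mul_sum,
          ← Finset.sum_div, hp1, hq1]
        ring
    _ ≤ 2 * a * (1 - affinity p q) + (2 + 2 * 1) / (4 * a) := by
        gcongr
        exact affinity_le_one hp hq hp1 hq1
    _ = 2 * a * (1 - affinity p q) + 1 / a := by
        field_simp
        ring

theorem sum_negMulLog_le_log_card {p : Λ → ℝ} (hp : ∀ l, 0 ≤ p l) (hp1 : ∑ l, p l = 1) :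
    ∑ l, Real.negMulLog (p l) ≤ Real.log (Fintype.card Λ) := by
  have : Nonempty Λ := by
    by_contra h_empty
    rw [not_nonempty_iff] at h_empty
    simp at hp1
  have h_card : (0 : ℝ) < Fintype.card Λ := by exact_mod_cast Fintype.card_pos
  have h_jensen := Real.concaveOn_negMulLog.le_map_sum (t := Finset.univ)
    (w := fun _ : Λ => (Fintype.card Λ : ℝ)⁻¹) (p := p) (fun _ _ => by positivity)
    (by simp [h_card.ne']) fun l _ => hp l
  simp only [smul_eq_mul, ← Finset.mul_sum, hp1, mul_one] at h_jensen
  rw [Real.negMulLog, Real.log_inv, neg_mul_neg] at h_jensen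
  exact le_of_mul_le_mul_left h_jensen (inv_pos.2 h_card)

theorem one_add_sum_le_sqrt_prod {ι : Type*} [Fintype ι] {r : ι → ℝ} (hr : ∀ j, 1 / 2 ≤ r j) :
    1 + ∑ j, ((r j - 1) / 2 - (r j - 1) ^ 2) ≤ √(∏ j, r j) :=
  calc 1 + ∑ j, ((r j - 1) / 2 - (r j - 1) ^ 2)
      = (∑ j, (r j - 1 - 2 * (r j - 1) ^ 2)) / 2 + 1 := by
        rw [Finset.sum_div, add_comm]
        exact congrArg (· + 1) (Finset.sum_congr rfl fun j _ => by ring)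
    _ ≤ Real.exp ((∑ j, (r j - 1 - 2 * (r j - 1) ^ 2)) / 2) := Real.add_one_le_exp _
    _ = √(∏ j, Real.exp (r j - 1 - 2 * (r j - 1) ^ 2)) := by rw [Real.exp_half, Real.exp_sum]
    _ ≤ √(∏ j, r j) := Real.sqrt_le_sqrt <|
        Finset.prod_le_prod (fun _ _ => (Real.exp_pos _).le) fun j _ => by
          simpa using exp_sub_two_mul_sq_le_one_add (x := r j - 1) (by linarith [hr j])

end Affinity

/-! ### Product measures on partitions into rectangles -/

/-- A partition of `ι → X` into measurable rectangles, each of which restricts at most `B`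
coordinates. -/
structure RectanglePartition (ι X Λ : Type*) [MeasurableSpace X] (B : ℕ) where
  side : Λ → ι → Set X
  measurableSet_side : ∀ l j, MeasurableSet (side l j)
  existsUnique : ∀ x : ι → X, ∃! l, ∀ j, x j ∈ side l j
  support : Λ → Finset ι
  card_support_le : ∀ l, (support l).card ≤ B
  side_eq_univ : ∀ l, ∀ j ∉ support l, side l j = Set.univ

namespace RectanglePartition

variable {ι X Λ κ : Type*} [Fintype ι] [MeasurableSpace X] {B : ℕ} {P : RectanglePartition ι X Λ B}
  {N₀ N : Measure X} {l : Λ}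

/-- The probability of the rectangle `l` under the product of copies of `N`. -/
noncomputable def mass (P : RectanglePartition ι X Λ B) (N : Measure X) (l : Λ) : ℝ :=
  ∏ j, N.real (P.side l j)

/-- The ratio of the `N`- and `N₀`-probabilities of the `j`-th side of the rectangle `l`. -/
noncomputable def sideRatio (P : RectanglePartition ι X Λ B) (N₀ N : Measure X) (l : Λ) (j : ι) :
    ℝ :=
  N.real (P.side l j) / N₀.real (P.side l j)

/-- The sum of the squared relative deviations of the sides of the rectangle `l`. -/
noncomputable def deviation (P : RectanglePartition ι X Λ B) (N₀ N : Measure X) (l : Λ) : ℝ :=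
  ∑ j, (P.sideRatio N₀ N l j - 1) ^ 2

theorem mass_nonneg (P : RectanglePartition ι X Λ B) (N : Measure X) (l : Λ) : 0 ≤ P.mass N l :=
  Finset.prod_nonneg fun _ _ => measureReal_nonneg

theorem deviation_nonneg (P : RectanglePartition ι X Λ B) (N₀ N : Measure X) (l : Λ) :
    0 ≤ P.deviation N₀ N l :=
  Finset.sum_nonneg fun _ _ => sq_nonneg _

theorem measureReal_side_pos (h : 0 < P.mass N l) (j : ι) : 0 < N.real (P.side l j) :=
  measureReal_nonneg.lt_of_ne' (Finset.prod_ne_zero_iff.1 h.ne' j (Finset.mem_univ j))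

theorem sum_prod_measureReal_eq (P : RectanglePartition ι X Λ B) (ν : ι → Measure X)
    [∀ j, IsProbabilityMeasure (ν j)] (A : Finset Λ) :
    ∑ l ∈ A, ∏ j, (ν j).real (P.side l j) =
      (Measure.pi ν).real {x | ∃ l ∈ A, ∀ j, x j ∈ P.side l j} := by
  have h_iUnion : {x : ι → X | ∃ l ∈ A, ∀ j, x j ∈ P.side l j} =
      ⋃ l ∈ A, Set.pi Set.univ (P.side l) := by
    ext x
    simp
  rw [h_iUnion, measureReal_biUnion_finset]
  · exact Finset.sum_congr rfl fun l _ => by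
      simp only [measureReal_def, Measure.pi_pi, ENNReal.toReal_prod]
  · exact fun l _ l' _ hne => Set.disjoint_left.2 fun x hx hx' =>
      hne ((P.existsUnique x).unique (by simpa using hx) (by simpa using hx'))
  · exact fun l _ => MeasurableSet.univ_pi fun j => P.measurableSet_side l j

variable [Fintype Λ]

theorem sum_prod_measureReal_eq_one (P : RectanglePartition ι X Λ B) (ν : ι → Measure X)
    [∀ j, IsProbabilityMeasure (ν j)] : ∑ l, ∏ j, (ν j).real (P.side l j) = 1 := by
  have h_univ : {x : ι → X | ∃ l ∈ Finset.univ, ∀ j, x j ∈ P.side l j} = Set.univ :=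
    Set.eq_univ_of_forall fun x => (P.existsUnique x).exists.imp fun l hl => ⟨Finset.mem_univ l, hl⟩
  rw [P.sum_prod_measureReal_eq ν Finset.univ, h_univ, probReal_univ]

theorem sum_mass (P : RectanglePartition ι X Λ B) (N : Measure X) [IsProbabilityMeasure N] :
    ∑ l, P.mass N l = 1 :=
  P.sum_prod_measureReal_eq_one fun _ => N

omit [Fintype Λ] in
theorem mass_mul_sideRatio_eq_prod [DecidableEq ι] (hac : N ≪ N₀) [IsFiniteMeasure N₀]
    (P : RectanglePartition ι X Λ B) (l : Λ) (j : ι) :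
    P.mass N₀ l * P.sideRatio N₀ N l j =
      ∏ j', (Function.update (fun _ => N₀) j N j').real (P.side l j') := by
  have h_side : N₀.real (P.side l j) * P.sideRatio N₀ N l j = N.real (P.side l j) :=
    mul_div_cancel_of_imp' fun h0 => by
      rw [measureReal_def, hac ((measureReal_eq_zero_iff).1 h0), ENNReal.toReal_zero]
  rw [mass, ← Finset.mul_prod_erase _ _ (Finset.mem_univ j),
    ← Finset.mul_prod_erase _ _ (Finset.mem_univ j), mul_right_comm, h_side,
    Function.update_self]
  congr 1
  exact Finset.prod_congr rfl fun j' hj' => by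
    rw [Function.update_of_ne (Finset.ne_of_mem_erase hj')]

-- Replacing the `j`-th factor of the product measure by `N` gives another product measure, for
-- which the masses of the rectangles again sum to one.
theorem sum_mass_mul_sideRatio (hac : N ≪ N₀) [IsProbabilityMeasure N₀] [IsProbabilityMeasure N]
    (P : RectanglePartition ι X Λ B) (j : ι) : ∑ l, P.mass N₀ l * P.sideRatio N₀ N l j = 1 := by
  classical
  have h_prob : ∀ j', IsProbabilityMeasure (Function.update (fun _ => N₀) j N j') := fun j' => by
    rw [Function.update_apply]
    split_ifs <;> infer_instance
  simp_rw [mass_mul_sideRatio_eq_prod hac]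
  exact P.sum_prod_measureReal_eq_one _

omit [Fintype Λ] in
theorem mass_mul_one_add_sum_le_sqrt [IsFiniteMeasure N₀]
    (hlow : ∀ E, MeasurableSet E → 1 / 2 * N₀.real E ≤ N.real E)
    (P : RectanglePartition ι X Λ B) (l : Λ) :
    P.mass N₀ l * (1 + ∑ j, ((P.sideRatio N₀ N l j - 1) / 2 - (P.sideRatio N₀ N l j - 1) ^ 2)) ≤
      √(P.mass N₀ l * P.mass N l) := by
  rcases (P.mass_nonneg N₀ l).eq_or_lt with h0 | hpos
  · rw [← h0, zero_mul, zero_mul, Real.sqrt_zero]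
  have h_ratio : ∀ j, 1 / 2 ≤ P.sideRatio N₀ N l j := fun j => by
    rw [sideRatio, le_div_iff₀ (measureReal_side_pos hpos j)]
    exact hlow _ (P.measurableSet_side l j)
  have h_mass : P.mass N₀ l * P.mass N l = P.mass N₀ l ^ 2 * ∏ j, P.sideRatio N₀ N l j := by
    have h_prod : ∏ j, P.sideRatio N₀ N l j = P.mass N l / P.mass N₀ l :=
      Finset.prod_div_distrib ..
    rw [h_prod]
    field_simp
  rw [h_mass, Real.sqrt_mul (sq_nonneg _), Real.sqrt_sq hpos.le]
  exact mul_le_mul_of_nonneg_left (one_add_sum_le_sqrt_prod h_ratio) hpos.le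

theorem one_sub_le_affinity (hac : N ≪ N₀) [IsProbabilityMeasure N₀] [IsProbabilityMeasure N]
    (hlow : ∀ E, MeasurableSet E → 1 / 2 * N₀.real E ≤ N.real E)
    (P : RectanglePartition ι X Λ B) :
    1 - ∑ l, P.mass N₀ l * P.deviation N₀ N l ≤ affinity (P.mass N₀) (P.mass N) := by
  have h_linear : ∑ l, P.mass N₀ l * ∑ j, (P.sideRatio N₀ N l j - 1) = 0 := by
    simp_rw [Finset.mul_sum, mul_sub, mul_one]
    rw [Finset.sum_comm]
    exact Finset.sum_eq_zero fun j _ => by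
      rw [Finset.sum_sub_distrib, sum_mass_mul_sideRatio hac, P.sum_mass, sub_self]
  calc 1 - ∑ l, P.mass N₀ l * P.deviation N₀ N l
      = ∑ l, P.mass N₀ l + (∑ l, P.mass N₀ l * ∑ j, (P.sideRatio N₀ N l j - 1)) / 2 -
          ∑ l, P.mass N₀ l * P.deviation N₀ N l := by rw [P.sum_mass, h_linear]; ring
    _ = ∑ l, P.mass N₀ l *
          (1 + ∑ j, ((P.sideRatio N₀ N l j - 1) / 2 - (P.sideRatio N₀ N l j - 1) ^ 2)) := by
        rw [Finset.sum_div, ← Finset.sum_add_distrib, ← Finset.sum_sub_distrib]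
        refine Finset.sum_congr rfl fun l _ => ?_
        rw [deviation, Finset.sum_sub_distrib (fun j => (P.sideRatio N₀ N l j - 1) / 2),
          ← Finset.sum_div]
        ring
    _ ≤ affinity (P.mass N₀) (P.mass N) :=
        Finset.sum_le_sum fun l _ => mass_mul_one_add_sum_le_sqrt hlow P l

omit [Fintype Λ] in
theorem log_mass [IsProbabilityMeasure N] (h : 0 < P.mass N l) :
    Real.log (P.mass N l) = ∑ j ∈ P.support l, Real.log (N.real (P.side l j)) := by
  rw [mass, Real.log_prod fun j _ => (measureReal_side_pos h j).ne',
    ← Finset.sum_subset (Finset.subset_univ (P.support l))]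
  intro j _ hj
  rw [P.side_eq_univ l j hj, probReal_univ, Real.log_one]

variable [Fintype κ] {N : κ → Measure X} {K : ℝ}

omit [Fintype Λ] in
theorem sum_deviation_le [IsProbabilityMeasure N₀] [∀ i, IsProbabilityMeasure (N i)]
    (hN : HasLevelOneBound N₀ N K) (h : 0 < P.mass N₀ l) :
    ∑ i, P.deviation N₀ (N i) l ≤ K * (3 * B - Real.log (P.mass N₀ l)) :=
  calc ∑ i, P.deviation N₀ (N i) l
      = ∑ j ∈ P.support l, ∑ i, (P.sideRatio N₀ (N i) l j - 1) ^ 2 := by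
        simp only [deviation]
        rw [Finset.sum_comm, ← Finset.sum_subset (Finset.subset_univ (P.support l))]
        intro j _ hj
        simp [sideRatio, P.side_eq_univ l j hj]
    _ ≤ ∑ j ∈ P.support l, K * (3 - Real.log (N₀.real (P.side l j))) :=
        Finset.sum_le_sum fun j _ =>
          hN.sum_sq_le _ (P.measurableSet_side l j) (measureReal_side_pos h j)
    _ = K * (3 * (P.support l).card - Real.log (P.mass N₀ l)) := by
        rw [log_mass h, ← Finset.mul_sum, Finset.sum_sub_distrib, Finset.sum_const, nsmul_eq_mul,
          mul_comm 3]
    _ ≤ K * (3 * B - Real.log (P.mass N₀ l)) := by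
        have := hN.nonneg
        have := P.card_support_le l
        gcongr

theorem sum_mass_mul_deviation_le [IsProbabilityMeasure N₀] [∀ i, IsProbabilityMeasure (N i)]
    (hN : HasLevelOneBound N₀ N K) (P : RectanglePartition ι X Λ B) :
    ∑ i, ∑ l, P.mass N₀ l * P.deviation N₀ (N i) l ≤ K * (Real.log (Fintype.card Λ) + 3 * B) := by
  have h_pointwise : ∀ l, P.mass N₀ l * ∑ i, P.deviation N₀ (N i) l ≤
      K * (Real.negMulLog (P.mass N₀ l) + 3 * B * P.mass N₀ l) := fun l => by
    rcases (P.mass_nonneg N₀ l).eq_or_lt with h0 | hpos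
    · simp [← h0]
    · have := mul_le_mul_of_nonneg_left (sum_deviation_le hN hpos) hpos.le
      rw [Real.negMulLog]
      linarith
  rw [Finset.sum_comm]
  simp_rw [← Finset.mul_sum]
  refine (Finset.sum_le_sum fun l _ => h_pointwise l).trans ?_
  rw [← Finset.mul_sum, Finset.sum_add_distrib, ← Finset.mul_sum, P.sum_mass, mul_one]
  exact mul_le_mul_of_nonneg_left (add_le_add_left
    (sum_negMulLog_le_log_card (P.mass_nonneg N₀) (P.sum_mass N₀)) _) hN.nonneg

variable {M₀ M : Measure X} [IsProbabilityMeasure M₀] [IsProbabilityMeasure M] {G : Set X} {δ : ℝ}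

omit [Fintype Λ] in
theorem pow_mul_mass_cond_le (P : RectanglePartition ι X Λ B) (hG : MeasurableSet G) {γ : ℝ}
    (hγ0 : 0 < γ) (hγ : γ ≤ M.real G) (l : Λ) :
    γ ^ B * P.mass (ProbabilityTheory.cond M G) l ≤ P.mass M l := by
  classical
  have hG_pos : 0 < M.real G := hγ0.trans_le hγ
  have h_side : ∀ E, γ * (ProbabilityTheory.cond M G).real E ≤ M.real E := fun E =>
    calc γ * (ProbabilityTheory.cond M G).real E
        ≤ M.real G * (ProbabilityTheory.cond M G).real E :=
          mul_le_mul_of_nonneg_right hγ measureReal_nonneg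
      _ = M.real (G ∩ E) := by rw [measureReal_cond_apply hG, mul_inv_cancel_left₀ hG_pos.ne']
      _ ≤ M.real E := measureReal_mono Set.inter_subset_right
  calc γ ^ B * P.mass (ProbabilityTheory.cond M G) l
      ≤ γ ^ (P.support l).card * P.mass (ProbabilityTheory.cond M G) l :=
        mul_le_mul_of_nonneg_right (pow_le_pow_of_le_one hγ0.le (hγ.trans measureReal_le_one)
          (P.card_support_le l)) (P.mass_nonneg _ l)
    _ = ∏ j, ((if j ∈ P.support l then γ else 1) *
          (ProbabilityTheory.cond M G).real (P.side l j)) := by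
        rw [Finset.prod_mul_distrib, Finset.prod_ite_mem, Finset.univ_inter, Finset.prod_const,
          mass]
    _ ≤ P.mass M l := by
        refine Finset.prod_le_prod (fun j _ => by split_ifs <;> positivity) fun j _ => ?_
        split_ifs with hj
        · exact h_side _
        · rw [P.side_eq_univ l j hj, probReal_univ (μ := M), one_mul]
          exact measureReal_le_one

theorem pow_mul_affinity_cond_le (P : RectanglePartition ι X Λ B) (hG : MeasurableSet G)
    {γ : ℝ} (hγ0 : 0 < γ) (hγ₀ : γ ≤ M₀.real G) (hγ : γ ≤ M.real G) :
    γ ^ B * affinity (P.mass (ProbabilityTheory.cond M₀ G)) (P.mass (ProbabilityTheory.cond M G)) ≤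
      affinity (P.mass M₀) (P.mass M) := by
  rw [affinity, affinity, Finset.mul_sum]
  refine Finset.sum_le_sum fun l _ => Real.le_sqrt_of_sq_le ?_
  have hγB : 0 ≤ γ ^ B := pow_nonneg hγ0.le B
  rw [mul_pow, Real.sq_sqrt (mul_nonneg (P.mass_nonneg _ l) (P.mass_nonneg _ l)), sq,
    mul_mul_mul_comm]
  exact mul_le_mul (P.pow_mul_mass_cond_le hG hγ0 hγ₀ l) (P.pow_mul_mass_cond_le hG hγ0 hγ l)
    (mul_nonneg hγB (P.mass_nonneg _ l)) (P.mass_nonneg _ l)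

theorem one_sub_sub_le_affinity_of_cond (P : RectanglePartition ι X Λ B) (hG : MeasurableSet G)
    (hδ0 : 0 ≤ δ) (hδ1 : δ < 1) (hG₀ : 1 - δ ≤ M₀.real G) (hGM : 1 - δ ≤ M.real G) {D : ℝ}
    (hD0 : 0 ≤ D) (hD : 1 - D ≤ affinity (P.mass (ProbabilityTheory.cond M₀ G))
      (P.mass (ProbabilityTheory.cond M G))) :
    1 - (B * δ + D) ≤ affinity (P.mass M₀) (P.mass M) := by
  have hδ1' : 0 < 1 - δ := by linarith
  have h_bernoulli : 1 - B * δ ≤ (1 - δ) ^ B := by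
    have := one_add_mul_le_pow (a := -δ) (by linarith) B
    rw [← sub_eq_add_neg] at this
    linarith
  have h_pow : (1 - δ) ^ B ≤ 1 := pow_le_one₀ hδ1'.le (by linarith)
  calc 1 - (B * δ + D) ≤ (1 - δ) ^ B * (1 - D) := by nlinarith
    _ ≤ (1 - δ) ^ B * affinity (P.mass (ProbabilityTheory.cond M₀ G))
          (P.mass (ProbabilityTheory.cond M G)) :=
        mul_le_mul_of_nonneg_left hD (pow_nonneg hδ1'.le B)
    _ ≤ affinity (P.mass M₀) (P.mass M) := P.pow_mul_affinity_cond_le hG hδ1' hG₀ hGM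

theorem sum_mass_fiber_le [DecidableEq κ] {M : κ → Measure X} [∀ i, IsProbabilityMeasure (M i)]
    (P : RectanglePartition ι X Λ B) (hG : MeasurableSet G) (hδ0 : 0 ≤ δ) (hδ1 : δ < 1)
    (hG₀ : 1 - δ ≤ M₀.real G) (hGi : ∀ i, 1 - δ ≤ (M i).real G)
    (hM : HasLevelOneBound (ProbabilityTheory.cond M₀ G)
      (fun i => ProbabilityTheory.cond (M i) G) K) {a b : ℝ} (ha : 0 < a)
    (hΛ : Real.log (Fintype.card Λ) ≤ b) (out : Λ → κ) :
    ∑ i, ∑ l with out l = i, P.mass (M i) l ≤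
      1 + 2 * a * (Fintype.card κ * (B * δ) + K * (b + 3 * B)) + Fintype.card κ / a := by
  have h_cond_prob : ∀ (Q : Measure X) [IsFiniteMeasure Q], 1 - δ ≤ Q.real G →
      IsProbabilityMeasure (ProbabilityTheory.cond Q G) := fun Q _ hQ =>
    ProbabilityTheory.cond_isProbabilityMeasure fun h0 => by
      rw [measureReal_def, h0, ENNReal.toReal_zero] at hQ
      linarith
  have := h_cond_prob M₀ hG₀
  have := fun i => h_cond_prob (M i) (hGi i)
  set D : κ → ℝ := fun i => ∑ l, P.mass (ProbabilityTheory.cond M₀ G) l *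
    P.deviation (ProbabilityTheory.cond M₀ G) (ProbabilityTheory.cond (M i) G) l
  have hD0 : ∀ i, 0 ≤ D i := fun i => Finset.sum_nonneg fun l _ =>
    mul_nonneg (P.mass_nonneg _ l) (P.deviation_nonneg _ _ l)
  have h_each : ∀ i, ∑ l with out l = i, P.mass (M i) l ≤
      ∑ l with out l = i, P.mass M₀ l + (2 * a * (B * δ + D i) + 1 / a) := fun i => by
    have h_affinity := P.one_sub_sub_le_affinity_of_cond hG hδ0 hδ1 hG₀ (hGi i) (hD0 i)
      (one_sub_le_affinity (hM.absolutelyContinuous i) (hM.half_le i) P)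
    have h_sub := sum_sub_sum_le_of_affinity (P.mass_nonneg M₀) (P.mass_nonneg (M i))
      (P.sum_mass _) (P.sum_mass _) ha {l | out l = i}
    linarith [mul_le_mul_of_nonneg_left (sub_le_comm.1 h_affinity) (by positivity : 0 ≤ 2 * a)]
  calc _ ≤ ∑ i, (∑ l with out l = i, P.mass M₀ l + (2 * a * (B * δ + D i) + 1 / a)) :=
        Finset.sum_le_sum fun i _ => h_each i
    _ = 1 + 2 * a * (Fintype.card κ * (B * δ) + ∑ i, D i) + Fintype.card κ / a := by
        simp only [Finset.sum_add_distrib, Finset.sum_fiberwise, P.sum_mass, ← Finset.mul_sum,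
          Finset.sum_const, Finset.card_univ, nsmul_eq_mul]
        ring
    _ ≤ _ := by
        have h_dev := sum_mass_mul_deviation_le hM P
        have := hM.nonneg
        gcongr
        exact h_dev.trans (by gcongr)

end RectanglePartition

/-! ### Transcripts of a protocol -/

theorem measurableSet_comp_of_countable {α β : Type*} [MeasurableSpace α] [Countable β]
    {f : α → β} {Q : β → α → Prop} (hf : ∀ b, MeasurableSet {a | f a = b})
    (hQ : ∀ b, MeasurableSet {a | Q b a}) : MeasurableSet {a | Q (f a) a} := by
  have h_iUnion : {a | Q (f a) a} = ⋃ b, {a | f a = b} ∩ {a | Q b a} := by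
    ext a
    simp
  rw [h_iUnion]
  exact MeasurableSet.iUnion fun b => (hf b).inter (hQ b)

theorem measureReal_prod_eq_integral {α β : Type*} [MeasurableSpace α] [MeasurableSpace β]
    {μ : Measure α} {ν : Measure β} [IsFiniteMeasure ν] {s : Set (α × β)} (hs : MeasurableSet s) :
    (μ.prod ν).real s = ∫ a, ν.real (Prod.mk a ⁻¹' s) ∂μ := by
  rw [measureReal_def, Measure.prod_apply hs]
  exact (integral_toReal (measurable_measure_prodMk_left hs).aemeasurable
    (Filter.Eventually.of_forall fun a => measure_lt_top _ _)).symm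

theorem card_le_sum_pow_of_forall_length_le {α : Type*} [Fintype α] {s : Finset (List α)} {B : ℕ}
    (hs : ∀ h ∈ s, h.length ≤ B) : s.card ≤ ∑ b ∈ Finset.range (B + 1), Fintype.card α ^ b := by
  classical
  have h_subset : s ⊆ (Finset.range (B + 1)).biUnion fun b =>
      (Finset.univ : Finset (List.Vector α b)).image List.Vector.toList := fun h hh =>
    Finset.mem_biUnion.2 ⟨h.length, Finset.mem_range.2 (Nat.lt_succ_of_le (hs h hh)),
      Finset.mem_image.2 ⟨⟨h, rfl⟩, Finset.mem_univ _, rfl⟩⟩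
  refine (Finset.card_le_card h_subset).trans (Finset.card_biUnion_le.trans ?_)
  exact Finset.sum_le_sum fun b _ => Finset.card_image_le.trans (card_vector b).le

namespace Protocol

variable {m k : ℕ} {X R : Type*} [MeasurableSpace X] [MeasurableSpace R] (π : Protocol m k X R)

theorem history_succ_of_none {r : R} {x : Fin m → X} {t : ℕ}
    (h : π.next r (π.history r x t) = none) : π.history r x (t + 1) = π.history r x t := by
  rw [history, h]

theorem history_succ_of_some {r : R} {x : Fin m → X} {t : ℕ} {j : Fin m}
    (h : π.next r (π.history r x t) = some j) :
    π.history r x (t + 1) = π.history r x t ++ [π.bit j (x j) r (π.history r x t)] := by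
  rw [history, h]

theorem history_add_of_none {r : R} {x : Fin m → X} {t : ℕ}
    (h : π.next r (π.history r x t) = none) (s : ℕ) :
    π.history r x (t + s) = π.history r x t := by
  induction s with
  | zero => rfl
  | succ s ih => rw [← add_assoc, π.history_succ_of_none (by rw [ih, h]), ih]

theorem length_history_succ {r : R} {x : Fin m → X} {t : ℕ}
    (h : π.next r (π.history r x t) ≠ none) : (π.history r x (t + 1)).length = t + 1 := by
  obtain ⟨j, hj⟩ := Option.ne_none_iff_exists'.1 h
  rw [π.history_succ_of_some hj, List.length_append, List.length_singleton]
  cases t with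
  | zero => rfl
  | succ t => rw [length_history_succ fun h0 => h (by rw [π.history_succ_of_none h0, h0])]

theorem history_prefix (r : R) (x : Fin m → X) {s t : ℕ} (hst : s ≤ t) :
    π.history r x s <+: π.history r x t := by
  induction t, hst using Nat.le_induction with
  | base => exact List.prefix_rfl
  | succ t _ ih =>
    refine ih.trans ?_
    rcases hn : π.next r (π.history r x t) with _ | j
    · rw [π.history_succ_of_none hn]
    · rw [π.history_succ_of_some hn]
      exact List.prefix_append _ _

theorem measurableSet_history (t : ℕ) (h : List Bool) :
    MeasurableSet {p : R × (Fin m → X) | π.history p.1 p.2 t = h} := by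
  induction t generalizing h with
  | zero => exact MeasurableSet.const ([] = h)
  | succ t ih =>
    refine measurableSet_comp_of_countable
      (Q := fun h' (p : R × (Fin m → X)) => (match π.next p.1 h' with
        | none => h'
        | some j => h' ++ [π.bit j (p.2 j) p.1 h']) = h) ih fun h' => ?_
    refine measurableSet_comp_of_countable
      (Q := fun o (p : R × (Fin m → X)) => (match o with
        | none => h'
        | some j => h' ++ [π.bit j (p.2 j) p.1 h']) = h)
      (fun o => measurable_fst (π.measurableSet_next h' o)) fun o => ?_
    rcases o with _ | j
    · exact MeasurableSet.const (h' = h)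
    · have h_bit : Measurable fun p : R × (Fin m → X) => π.bit j (p.2 j) p.1 h' :=
        (π.measurable_bit j h').comp (by fun_prop : Measurable fun p : R × (Fin m → X) =>
          (p.2 j, p.1))
      exact h_bit (MeasurableSet.of_discrete (s := {b | h' ++ [b] = h}))

theorem measurableSet_output_history (t : ℕ) (i : Fin k) :
    MeasurableSet {p : R × (Fin m → X) | π.output p.1 (π.history p.1 p.2 t) = i} :=
  measurableSet_comp_of_countable (Q := fun h (p : R × (Fin m → X)) => π.output p.1 h = i)
    (π.measurableSet_history t) fun h => measurable_fst (π.measurableSet_output h i)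

/-- The inputs of party `j` that are consistent with the transcript `h`. -/
def consistent (r : R) (h : List Bool) (j : Fin m) : Set X :=
  {x | ∀ t, ∀ ht : t < h.length, π.next r (h.take t) = some j → π.bit j x r (h.take t) = h[t]}

/-- The parties that sent at least one bit of the transcript `h`. -/
def speakers (r : R) (h : List Bool) : Finset (Fin m) :=
  (Finset.range h.length).biUnion fun t => (π.next r (h.take t)).toFinset

theorem card_speakers_le (r : R) (h : List Bool) : (π.speakers r h).card ≤ h.length := by
  refine (Finset.card_biUnion_le_card_mul _ _ 1 fun t _ => ?_).trans (by simp)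
  rw [Option.card_toFinset]
  cases π.next r (h.take t) <;> simp

theorem consistent_eq_univ {r : R} {h : List Bool} {j : Fin m} (hj : j ∉ π.speakers r h) :
    π.consistent r h j = Set.univ :=
  Set.eq_univ_of_forall fun _ t ht hn =>
    absurd (Finset.mem_biUnion.2 ⟨t, Finset.mem_range.2 ht, by simp [hn]⟩) hj

theorem measurableSet_consistent (r : R) (h : List Bool) (j : Fin m) :
    MeasurableSet (π.consistent r h j) := by
  have h_iInter : π.consistent r h j = ⋂ t, ⋂ ht : t < h.length,
      ⋂ _ : π.next r (h.take t) = some j, {x | π.bit j x r (h.take t) = h[t]} := by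
    ext x
    simp [consistent]
  rw [h_iInter]
  refine MeasurableSet.iInter fun t => MeasurableSet.iInter fun ht =>
    MeasurableSet.iInter fun _ => ?_
  exact (π.measurable_bit j _).comp measurable_prodMk_right (measurableSet_singleton _)

theorem mem_consistent_history (r : R) (x : Fin m → X) (t : ℕ) (j : Fin m) :
    x j ∈ π.consistent r (π.history r x t) j := by
  induction t with
  | zero => exact fun s hs => absurd hs (Nat.not_lt_zero s)
  | succ t ih =>
    rcases hn : π.next r (π.history r x t) with _ | j'
    · rwa [π.history_succ_of_none hn]
    rw [π.history_succ_of_some hn]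
    intro s hs hnext
    rw [List.length_append, List.length_singleton] at hs
    rcases Nat.lt_succ_iff_lt_or_eq.1 hs with h | rfl
    · rw [List.take_append_of_le_length h.le] at hnext ⊢
      rw [List.getElem_append_left h]
      exact ih s h hnext
    · rw [List.take_left] at hnext ⊢
      obtain rfl : j' = j := Option.some_inj.1 (hn.symm.trans hnext)
      exact (List.getElem_concat_length rfl _).symm

theorem history_eq_of_mem_consistent {r : R} {x x' : Fin m → X} {B : ℕ}
    (h : ∀ j, x j ∈ π.consistent r (π.history r x' B) j) {t : ℕ} (ht : t ≤ B) :
    π.history r x t = π.history r x' t := by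
  induction t with
  | zero => rfl
  | succ t ih =>
    have ih' := ih (by omega)
    rcases hn : π.next r (π.history r x' t) with _ | j
    · rw [π.history_succ_of_none hn, π.history_succ_of_none (by rw [ih', hn]), ih']
    obtain ⟨l, hl⟩ := π.history_prefix r x' ht
    rw [π.history_succ_of_some hn, List.append_assoc] at hl
    rw [π.history_succ_of_some hn, π.history_succ_of_some (by rw [ih', hn]), ih']
    have h_lt : (π.history r x' t).length < (π.history r x' B).length := by
      rw [← hl]
      simp
    have h_take : (π.history r x' B).take (π.history r x' t).length = π.history r x' t := by
      rw [← hl, List.take_left]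
    have h_bit := h j _ h_lt (by rw [h_take, hn])
    rw [h_take] at h_bit
    rw [h_bit]
    simp [← hl]

/-- The histories that occur on seed `r` after at most `B` bits. -/
abbrev Transcript (B : ℕ) (r : R) : Type :=
  Set.range fun x => π.history r x B

theorem communicationComplexity_le_iff {B : ℕ} :
    π.communicationComplexity ≤ B ↔ ∀ r x t, (π.history r x t).length ≤ B := by
  simp only [communicationComplexity, iSup_le_iff, Nat.cast_le]

variable {π} {B : ℕ}

theorem length_history_le (hB : π.communicationComplexity ≤ B) (r : R) (x : Fin m → X) (t : ℕ) :
    (π.history r x t).length ≤ B :=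
  π.communicationComplexity_le_iff.1 hB r x t

theorem outputs_iff_output_history_eq (hB : π.communicationComplexity ≤ B) (r : R) (x : Fin m → X)
    (i : Fin k) : π.Outputs r x i ↔ π.output r (π.history r x B) = i := by
  have h_halted : π.next r (π.history r x B) = none := by
    by_contra h
    have h_length := π.length_history_succ h
    have := length_history_le hB r x (B + 1)
    omega
  refine ⟨fun ⟨t, ht, hti⟩ => ?_, fun h => ⟨B, h_halted, h⟩⟩
  rwa [← π.history_add_of_none h_halted t, add_comm, π.history_add_of_none ht B]

/-- The partition of the inputs according to the transcript of a protocol that sends at most `B`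
bits. -/
def transcriptPartition (hB : π.communicationComplexity ≤ B) (r : R) :
    RectanglePartition (Fin m) X (π.Transcript B r) B where
  side h j := π.consistent r h j
  measurableSet_side h j := π.measurableSet_consistent r h j
  existsUnique x := by
    refine ⟨⟨_, x, rfl⟩, fun j => π.mem_consistent_history r x B j, ?_⟩
    rintro ⟨_, x', rfl⟩ h
    exact Subtype.ext (π.history_eq_of_mem_consistent h le_rfl).symm
  support h := π.speakers r h
  card_support_le := by
    rintro ⟨_, x, rfl⟩
    exact (π.card_speakers_le r _).trans (length_history_le hB r x B)
  side_eq_univ _ _ hj := π.consistent_eq_univ hj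

theorem finite_transcript (hB : π.communicationComplexity ≤ B) (r : R) :
    Finite (π.Transcript B r) :=
  (List.finite_length_le Bool B).subset (Set.range_subset_iff.2 fun x => length_history_le hB r x B)

theorem card_transcript_le (hB : π.communicationComplexity ≤ B) (r : R)
    [Fintype (π.Transcript B r)] : Fintype.card (π.Transcript B r) ≤ 2 ^ (B + 1) := by
  have h_card := card_le_sum_pow_of_forall_length_le
    (s := (Set.range fun x => π.history r x B).toFinset) (B := B) fun h hh => by
      obtain ⟨x, rfl⟩ := Set.mem_toFinset.1 hh
      exact length_history_le hB r x B
  rw [Set.toFinset_card, Fintype.card_bool, Nat.geomSum_eq le_rfl] at h_card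
  exact h_card.trans ((Nat.div_le_self _ _).trans (Nat.sub_le _ _))

theorem log_card_transcript_le (hB : π.communicationComplexity ≤ B) (r : R)
    [Fintype (π.Transcript B r)] : Real.log (Fintype.card (π.Transcript B r)) ≤ B + 1 := by
  rcases (Fintype.card (π.Transcript B r)).eq_zero_or_pos with h0 | hpos
  · rw [h0, Nat.cast_zero, Real.log_zero]
    positivity
  calc Real.log (Fintype.card (π.Transcript B r)) ≤ Real.log (2 ^ (B + 1)) :=
        Real.log_le_log (by exact_mod_cast hpos) (by exact_mod_cast card_transcript_le hB r)
    _ = (B + 1) * Real.log 2 := by rw [Real.log_pow, Nat.cast_add_one]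
    _ ≤ B + 1 := mul_le_of_le_one_right (by positivity) (by linarith [Real.log_two_lt_d9])

theorem measureReal_output_history_eq_sum_mass (hB : π.communicationComplexity ≤ B) (r : R)
    [Fintype (π.Transcript B r)] (N : Measure X) [IsProbabilityMeasure N] (i : Fin k) :
    (Measure.pi fun _ : Fin m => N).real {x | π.output r (π.history r x B) = i} =
      ∑ h with π.output r (h : π.Transcript B r) = i, (transcriptPartition hB r).mass N h := by
  refine Eq.trans ?_ ((transcriptPartition hB r).sum_prod_measureReal_eq (fun _ => N) _).symm
  congr 1
  ext x
  simp only [Finset.mem_filter, Finset.mem_univ, true_and, Set.mem_ofPred_eq]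
  constructor
  · exact fun hx => ⟨⟨_, x, rfl⟩, hx, fun j => π.mem_consistent_history r x B j⟩
  · rintro ⟨⟨_, x', rfl⟩, hi, hx⟩
    rwa [π.history_eq_of_mem_consistent hx le_rfl]

theorem sum_measureReal_outputs_le (hB : π.communicationComplexity ≤ B) (M : Fin k → Measure X)
    [∀ i, IsProbabilityMeasure (M i)] {b : ℝ}
    (hb : ∀ r, ∑ i, (Measure.pi fun _ : Fin m => M i).real
      {x | π.output r (π.history r x B) = i} ≤ b) :
    ∑ i, (π.coins.prod (Measure.pi fun _ : Fin m => M i)).real {p | π.Outputs p.1 p.2 i} ≤ b := by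
  have := π.prob_coins
  have h_measurable := π.measurableSet_output_history B
  simp_rw [outputs_iff_output_history_eq hB, measureReal_prod_eq_integral (h_measurable _)]
  rw [← integral_finsetSum _ fun i _ =>
    Measure.integrable_measure_prodMk_left (h_measurable i) (measure_ne_top _ _)]
  calc _ ≤ ∫ _, b ∂π.coins := integral_mono_of_nonneg
        (Filter.Eventually.of_forall fun _ => Finset.sum_nonneg fun _ _ => measureReal_nonneg)
        (integrable_const b) (Filter.Eventually.of_forall hb)
    _ = b := by rw [integral_const, probReal_univ, one_smul]

theorem sum_measureReal_outputs_le_of_hasLevelOneBound (hB : π.communicationComplexity ≤ B)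
    {M₀ : Measure X} [IsProbabilityMeasure M₀] {M : Fin k → Measure X}
    [∀ i, IsProbabilityMeasure (M i)] {G : Set X} (hG : MeasurableSet G) {δ K a : ℝ} (hδ0 : 0 ≤ δ)
    (hδ1 : δ < 1) (hG₀ : 1 - δ ≤ M₀.real G) (hGi : ∀ i, 1 - δ ≤ (M i).real G)
    (hM : HasLevelOneBound (ProbabilityTheory.cond M₀ G)
      (fun i => ProbabilityTheory.cond (M i) G) K) (ha : 0 < a) :
    ∑ i, (π.coins.prod (Measure.pi fun _ : Fin m => M i)).real {p | π.Outputs p.1 p.2 i} ≤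
      1 + 2 * a * (k * (B * δ) + K * (B + 1 + 3 * B)) + k / a := by
  refine sum_measureReal_outputs_le hB M fun r => ?_
  have := finite_transcript hB r
  have := Fintype.ofFinite (π.Transcript B r)
  have h_fiber := (transcriptPartition hB r).sum_mass_fiber_le hG hδ0 hδ1 hG₀ hGi hM ha
    (log_card_transcript_le hB r) fun h => π.output r h
  simp_rw [measureReal_output_history_eq_sum_mass hB]
  rwa [Fintype.card_fin] at h_fiber

end Protocol

/-! ### The correlation condition -/

section FinsetSums

variable {ι : Type*} [Fintype ι]

theorem sum_finset_eq_add_sum_two_le_card {M : Type*} [AddCommMonoid M] (f : Finset ι → M) :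
    ∑ S, f S = f ∅ + ∑ i, f {i} + ∑ S with 2 ≤ S.card, f S := by
  classical
  have h_small : ({S | ¬ 2 ≤ S.card} : Finset (Finset ι)) =
      insert ∅ (Finset.univ.map ⟨_, Finset.singleton_injective⟩) := by
    ext S
    simp only [Finset.mem_filter, Finset.mem_univ, true_and, Finset.mem_insert, Finset.mem_map,
      Function.Embedding.coeFn_mk, eq_comm (b := S), ← Finset.card_eq_one, ← Finset.card_eq_zero]
    omega
  rw [← Finset.sum_filter_not_add_sum_filter _ (fun S : Finset ι => 2 ≤ S.card), h_small,
    Finset.sum_insert (by simp), Finset.sum_map]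
  rfl

theorem sum_inv_card_pow_card_le_one :
    ∑ S : Finset ι with 2 ≤ S.card, (Fintype.card ι : ℝ)⁻¹ ^ S.card ≤ 1 := by
  rcases isEmpty_or_nonempty ι with h_empty | h_nonempty
  · exact (Finset.sum_eq_zero fun S hS => by
      simp [S.eq_empty_of_isEmpty] at hS).le.trans zero_le_one
  have h_all : ∑ S : Finset ι, (Fintype.card ι : ℝ)⁻¹ ^ S.card ≤ Real.exp 1 := by
    have h_prod := Finset.prod_one_add (f := fun _ : ι => (Fintype.card ι : ℝ)⁻¹)
      (s := Finset.univ)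
    simp only [Finset.prod_const, Finset.powerset_univ] at h_prod
    exact h_prod ▸ Real.one_add_inv_pow_le_exp
  have h_split := sum_finset_eq_add_sum_two_le_card fun S : Finset ι =>
    (Fintype.card ι : ℝ)⁻¹ ^ S.card
  simp only [Finset.card_empty, pow_zero, Finset.card_singleton, pow_one, Finset.sum_const,
    Finset.card_univ, nsmul_eq_mul] at h_split
  rw [mul_inv_cancel₀ (Nat.cast_ne_zero.2 Fintype.card_ne_zero)] at h_split
  linarith [Real.exp_one_lt_d9]

end FinsetSums

theorem rpow_neg_half_mul_rpow_neg {x y : ℝ} (hx : 0 ≤ x) (hy : 0 ≤ y) (s : ℕ) :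
    x ^ (-(s : ℝ) / 2) * y ^ (-(s : ℝ)) = ((√x * y) ^ s)⁻¹ := by
  rw [mul_pow, mul_inv, Real.rpow_neg hy, Real.rpow_natCast, neg_div, Real.rpow_neg hx,
    Real.sqrt_eq_rpow, ← Real.rpow_natCast (x ^ _), ← Real.rpow_mul hx, one_div_mul_eq_div]

theorem pow_succ_mul_le_sqrt_pow_succ {x y : ℝ} (hx : 0 < x) (hy : 0 < y) {ℓ : ℕ} (hℓ : 2 ≤ ℓ)
    (h : x ^ (2 * ((ℓ : ℝ) + 1) / ((ℓ : ℝ) - 1)) ≤ y) : x ^ (ℓ + 1) * y ≤ √y ^ (ℓ + 1) := by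
  have hℓ' : 0 < (ℓ : ℝ) - 1 := by
    have : (2 : ℝ) ≤ ℓ := by exact_mod_cast hℓ
    linarith
  have h_pow : x ^ (ℓ + 1) ≤ y ^ (((ℓ : ℝ) - 1) / 2) :=
    calc x ^ (ℓ + 1) = (x ^ (2 * ((ℓ : ℝ) + 1) / ((ℓ : ℝ) - 1))) ^ (((ℓ : ℝ) - 1) / 2) := by
          rw [← Real.rpow_mul hx.le, ← Real.rpow_natCast]
          congr 1
          push_cast
          field_simp
      _ ≤ y ^ (((ℓ : ℝ) - 1) / 2) := Real.rpow_le_rpow (by positivity) h (by positivity)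
  calc x ^ (ℓ + 1) * y ≤ y ^ (((ℓ : ℝ) - 1) / 2) * y := mul_le_mul_of_nonneg_right h_pow hy.le
    _ = √y ^ (ℓ + 1) := by
        rw [← Real.rpow_add_one hy.ne', Real.sqrt_eq_rpow, ← Real.rpow_natCast,
          ← Real.rpow_mul hy.le]
        congr 1
        push_cast
        ring

section CorrCondition

variable {Ω : Type*} [MeasurableSpace Ω] {k n : ℕ} {ρ : ℝ} {μ₀ : Measure Ω}
  {μ : Fin k → Measure Ω} {F : Fin k → Ω → ℝ}

theorem corrTerm_eq (hρ : 0 ≤ ρ)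
    (hF : ∀ i, (fun a => ((μ i).rnDeriv μ₀ a).toReal - 1) =ᵐ[μ₀] F i) (S : Finset (Fin k)) :
    corrTerm n ρ μ₀ μ S = ((√n * ρ) ^ S.card)⁻¹ * |∫ a, ∏ i ∈ S, F i a ∂μ₀| := by
  rw [corrTerm, rpow_neg_half_mul_rpow_neg n.cast_nonneg hρ]
  congr 2
  refine integral_congr_ae ?_
  filter_upwards [ae_all_iff.2 hF] with a ha
  exact Finset.prod_congr rfl fun i _ => ha i

theorem CorrCondition.sum_inv_pow_mul_abs_integral_le [IsProbabilityMeasure μ₀]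
    (h : CorrCondition n ρ μ₀ μ) (hρ : 0 ≤ ρ)
    (hF : ∀ i, (fun a => ((μ i).rnDeriv μ₀ a).toReal - 1) =ᵐ[μ₀] F i)
    (hF0 : ∀ i, ∫ a, F i a ∂μ₀ = 0) :
    ∑ T : Finset (Fin k), ((√n * ρ) ^ T.card)⁻¹ * |∫ a, ∏ i ∈ T, F i a ∂μ₀| ≤
      1 + (n : ℝ)⁻¹ := by
  rw [← one_div, sum_finset_eq_add_sum_two_le_card]
  refine add_le_add (by simp [hF0]) (le_of_eq_of_le ?_ h)
  exact Finset.sum_congr rfl fun S _ => (corrTerm_eq hρ hF S).symm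

theorem IsCenteredFamily.corrTerm_le_inv_sqrt_pow (h : IsCenteredFamily ρ μ₀ μ)
    (S : Finset (Fin k)) : corrTerm n ρ μ₀ μ S ≤ (√n ^ S.card)⁻¹ := by
  have := h.prob_center
  have := h.prob
  have hρ := h.rho_pos
  have h_integral : |∫ a, ∏ i ∈ S, truncatedDensityDev ρ μ₀ (μ i) a ∂μ₀| ≤ ρ ^ S.card := by
    have h_norm := norm_integral_le_of_norm_le_const (μ := μ₀)
      (f := fun a => ∏ i ∈ S, truncatedDensityDev ρ μ₀ (μ i) a) (C := ρ ^ S.card)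
      (ae_of_all _ fun a => (Finset.norm_prod_le S _).trans
        (Finset.prod_le_prod (fun _ _ => norm_nonneg _) fun i _ =>
          abs_truncatedDensityDev_le hρ.le a) |>.trans_eq (Finset.prod_const ρ))
    rwa [probReal_univ, mul_one] at h_norm
  rw [corrTerm_eq hρ.le fun i => rnDeriv_ae_eq_truncatedDensityDev (h.lower i) (h.upper i),
    mul_pow, mul_inv, mul_assoc]
  exact mul_le_of_le_one_right (by positivity) ((inv_mul_le_one₀ (by positivity)).2 h_integral)

theorem IsCenteredFamily.corrCondition_of_corrTerm_eq_zero (h : IsCenteredFamily ρ μ₀ μ)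
    (hn : 1 ≤ n) {ℓ : ℕ} (hℓ : 2 ≤ ℓ)
    (h_zero : ∀ S : Finset (Fin k), 2 ≤ S.card → S.card ≤ ℓ → corrTerm n ρ μ₀ μ S = 0)
    (hk : (k : ℝ) ^ (2 * ((ℓ : ℝ) + 1) / ((ℓ : ℝ) - 1)) ≤ n) : CorrCondition n ρ μ₀ μ := by
  have hn1 : (1 : ℝ) ≤ n := by exact_mod_cast hn
  have hk0 : (0 : ℝ) < k := by exact_mod_cast zero_lt_two.trans_le h.two_le
  have h_pow : (k : ℝ) ^ (ℓ + 1) * n ≤ √n ^ (ℓ + 1) :=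
    pow_succ_mul_le_sqrt_pow_succ hk0 (by linarith) hℓ hk
  have h_sqrt : (k : ℝ) ≤ √n := le_of_pow_le_pow_left₀ ℓ.succ_ne_zero (Real.sqrt_nonneg _)
    ((le_mul_of_one_le_right (by positivity) hn1).trans h_pow)
  have h_term : ∀ S : Finset (Fin k), 2 ≤ S.card →
      corrTerm n ρ μ₀ μ S ≤ 1 / n * (k : ℝ)⁻¹ ^ S.card := fun S hS => by
    rcases le_or_gt S.card ℓ with hSℓ | hSℓ
    · rw [h_zero S hS hSℓ]
      positivity
    obtain ⟨d, hd⟩ : ∃ d, S.card = ℓ + 1 + d := Nat.exists_eq_add_of_le hSℓ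
    refine (h.corrTerm_le_inv_sqrt_pow S).trans ?_
    rw [one_div, inv_pow, ← mul_inv]
    refine inv_anti₀ (by positivity) ?_
    calc (n : ℝ) * k ^ S.card = k ^ (ℓ + 1) * n * k ^ d := by rw [hd, pow_add _ (ℓ + 1)]; ring
      _ ≤ √n ^ (ℓ + 1) * √n ^ d := by gcongr
      _ = √n ^ S.card := by rw [hd, pow_add _ (ℓ + 1)]
  calc ∑ S : Finset (Fin k) with 2 ≤ S.card, corrTerm n ρ μ₀ μ S
      ≤ ∑ S : Finset (Fin k) with 2 ≤ S.card, 1 / (n : ℝ) * (k : ℝ)⁻¹ ^ S.card :=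
        Finset.sum_le_sum fun S hS => h_term S (Finset.mem_filter.1 hS).2
    _ = 1 / n * ∑ S : Finset (Fin k) with 2 ≤ S.card, (k : ℝ)⁻¹ ^ S.card := by
        rw [Finset.mul_sum]
    _ ≤ 1 / n := mul_le_of_le_one_right (by positivity) <| by
        simpa only [Fintype.card_fin] using sum_inv_card_pow_card_le_one (ι := Fin k)

end CorrCondition

/-! ### The lower bound -/

section Parameters

variable {k q x : ℝ}

theorem mul_sq_mul_log_le {n ρ c : ℝ} (hn : 0 < n) (hρ0 : 0 ≤ ρ) (hk : 1 < k)
    (h : ρ ≤ (n * Real.log k) ^ (-(1 / 2 : ℝ)) / c) : n * ρ ^ 2 * Real.log k ≤ 1 / c ^ 2 := by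
  have hy : 0 < n * Real.log k := mul_pos hn (Real.log_pos hk)
  have h_sq : ((n * Real.log k) ^ (-(1 / 2 : ℝ))) ^ 2 = (n * Real.log k)⁻¹ := by
    rw [← Real.rpow_mul_natCast hy.le, ← Real.rpow_neg_one]
    norm_num
  calc n * ρ ^ 2 * Real.log k = n * Real.log k * ρ ^ 2 := by ring
    _ ≤ n * Real.log k * ((n * Real.log k) ^ (-(1 / 2 : ℝ)) / c) ^ 2 := by gcongr
    _ = 1 / c ^ 2 := by rw [div_pow, h_sq, ← mul_div_assoc, mul_inv_cancel₀ hy.ne']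

theorem mul_neg_log_le_two_mul_sqrt (hq : 0 < q) : q * -Real.log q ≤ 2 * √q := by
  have h_log : -Real.log √q ≤ (√q)⁻¹ := by
    have := Real.log_le_sub_one_of_pos (inv_pos.2 (Real.sqrt_pos.2 hq))
    rw [Real.log_inv] at this
    linarith
  calc q * -Real.log q = q * (2 * -Real.log √q) := by rw [Real.log_sqrt hq.le]; ring
    _ ≤ q * (2 * (√q)⁻¹) := by gcongr
    _ = 2 * √q := by rw [mul_left_comm, ← div_eq_mul_inv, Real.div_sqrt]

theorem mul_log_div_le_of_mul_log_le (hk : 2 ≤ k) (hq : 0 < q)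
    (h : q * Real.log k ≤ 1 / (10 ^ 7) ^ 2) :
    q ≤ 1 / 100 ∧ q * Real.log (k / q) ≤ 1 / 10 ^ 6 := by
  have h_log : 1 / 2 ≤ Real.log k := by
    linarith [Real.log_two_gt_d9, Real.log_le_log zero_lt_two hk]
  have hq_le : q ≤ (2 / 10 ^ 7) ^ 2 := by nlinarith
  have h_sqrt : √q ≤ 2 / 10 ^ 7 := Real.sqrt_le_iff.2 ⟨by norm_num, hq_le⟩
  have h_neg := mul_neg_log_le_two_mul_sqrt hq
  refine ⟨hq_le.trans (by norm_num), ?_⟩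
  rw [Real.log_div (by linarith) hq.ne', mul_sub]
  linarith

theorem four_le_log_of_hundred_le (hx : 100 ≤ x) : 4 ≤ Real.log x := by
  rw [Real.le_log_iff_exp_le (by linarith)]
  calc Real.exp 4 = Real.exp 1 ^ 4 := by rw [← Real.exp_nat_mul]; norm_num
    _ ≤ 3 ^ 4 := pow_le_pow_left₀ (Real.exp_pos _).le (by linarith [Real.exp_one_lt_d9]) 4
    _ ≤ x := by linarith

theorem le_of_two_thirds_mul_le {B : ℝ} (hk : 2 ≤ k) (hq : 0 < q) (hkx : k = x * q)
    (hx : 100 ≤ x) (hqx : q * Real.log x ≤ 1 / 10 ^ 6) (hB : 0 ≤ B)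
    (h : 2 / 3 * k ≤ 1 + 2 * 12 * (k * (B * (2 / x ^ 3)) +
      512 * (q * Real.log x) * (B + 1 + 3 * B)) + k / 12) :
    k ≤ 10 ^ 7 * (q * Real.log x) * B := by
  have h_log := four_le_log_of_hundred_le hx
  by_contra! h_lt
  have hBx : B ≤ x := by
    have h_qB : B * q ≤ 10 ^ 7 * (q * Real.log x) * B := by nlinarith [mul_nonneg hB hq.le]
    exact le_of_mul_le_mul_right (hkx ▸ h_qB.trans h_lt.le) hq
  have hBδ : B * (2 / x ^ 3) ≤ 2 / 100 ^ 2 :=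
    calc B * (2 / x ^ 3) ≤ x * (2 / x ^ 3) := by gcongr
      _ = 2 / x ^ 2 := by field_simp
      _ ≤ 2 / 100 ^ 2 := by gcongr
  have hkB : k * (B * (2 / x ^ 3)) ≤ k * (2 / 100 ^ 2) := by gcongr
  linarith

theorem mul_sq_two_div_cube_le (hq : 0 ≤ q) (hx : 100 ≤ x) :
    x * q * (2 / x ^ 3) ^ 2 ≤ 64 * (q * Real.log x) := by
  have h_log := four_le_log_of_hundred_le hx
  have h_pow : 4 / x ^ 5 ≤ 4 := div_le_self (by norm_num) (one_le_pow₀ (by linarith))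
  calc x * q * (2 / x ^ 3) ^ 2 = q * (4 / x ^ 5) := by field_simp; norm_num
    _ ≤ q * (64 * Real.log x) := by gcongr; linarith
    _ = 64 * (q * Real.log x) := mul_left_comm _ _ _

theorem two_mul_exp_neg_eight_mul_log_le (hx : 100 ≤ x) (hk : k ≤ x) :
    2 * k * Real.exp (-(8 * Real.log x)) ≤ (2 / x ^ 3) ^ 2 / 2 := by
  have h_exp : Real.exp (-(8 * Real.log x)) = (x ^ 8)⁻¹ := by
    rw [Real.exp_neg, mul_comm, ← Real.rpow_def_of_pos (by linarith)]
    norm_cast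
  calc 2 * k * Real.exp (-(8 * Real.log x)) ≤ 2 * x * (x ^ 8)⁻¹ := by rw [h_exp]; gcongr
    _ = 2 / x ^ 7 := by field_simp
    _ ≤ 2 / x ^ 6 := by gcongr <;> [linarith; norm_num]
    _ = (2 / x ^ 3) ^ 2 / 2 := by field_simp

end Parameters

theorem IsCenteredFamily.exists_hasLevelOneBound_cond {Ω : Type*} [MeasurableSpace Ω] {k n : ℕ}
    {ρ x : ℝ} {μ₀ : Measure Ω} {μ : Fin k → Measure Ω} (h : IsCenteredFamily ρ μ₀ μ) (hn : 1 ≤ n)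
    (hcorr : CorrCondition n ρ μ₀ μ) (hkx : k = x * (n * ρ ^ 2)) (hx : 100 ≤ x)
    (hnρ : n * ρ ^ 2 ≤ 1 / 100) (hlog : n * ρ ^ 2 * Real.log x ≤ 1 / 10 ^ 6) :
    ∃ G : Set (Fin n → Ω), MeasurableSet G ∧
      1 - 2 / x ^ 3 ≤ (Measure.pi fun _ => μ₀).real G ∧
      (∀ i, 1 - 2 / x ^ 3 ≤ (Measure.pi fun _ => μ i).real G) ∧
      HasLevelOneBound (ProbabilityTheory.cond (Measure.pi fun _ => μ₀) G)
        (fun i => ProbabilityTheory.cond (Measure.pi fun _ => μ i) G)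
        (512 * (n * ρ ^ 2 * Real.log x)) := by
  have := h.prob_center
  have := h.prob
  have hρ := h.rho_pos
  have hn1 : (1 : ℝ) ≤ n := by exact_mod_cast hn
  have h_four := four_le_log_of_hundred_le hx
  have hμ : ∀ i, HasDensityDev μ₀ (μ i) (truncatedDensityDev ρ μ₀ (μ i)) := fun i =>
    hasDensityDev_truncatedDensityDev hρ.le h.rho_lt_one.le (h.lower i) (h.upper i)
  have hε : (√n * ρ) ^ 2 = n * ρ ^ 2 := by rw [mul_pow, Real.sq_sqrt n.cast_nonneg]
  set L : ℝ := 8 * (√n * ρ) * √(Real.log x)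
  have hL : L ^ 2 = 64 * (n * ρ ^ 2 * Real.log x) := by
    rw [mul_pow, mul_pow, hε, Real.sq_sqrt (by linarith)]
    ring
  rw [show 512 * (n * ρ ^ 2 * Real.log x) = 8 * L ^ 2 by rw [hL]; ring]
  have h_cube : (100 : ℝ) ^ 3 ≤ x ^ 3 := by gcongr
  have h_cond := hcorr.sum_inv_pow_mul_abs_integral_le hρ.le
    (fun i => rnDeriv_ae_eq_truncatedDensityDev (h.lower i) (h.upper i))
    fun i => (hμ i).integral_eq_zero
  have h_two : 2 ≤ √(Real.log x) := Real.le_sqrt_of_sq_le (by linarith)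
  have hε0 : 0 < √n * ρ := by positivity
  refine hasLevelOneBound_cond_pi (fun i a => abs_truncatedDensityDev_le hρ.le a) hμ ?_ hε0
    (by rw [Fintype.card_fin, hε]) (by rwa [Fintype.card_fin]) ?_ ?_ (by positivity) ?_ ?_ ?_
  · nlinarith
  · nlinarith
  · exact le_of_pow_le_pow_left₀ two_ne_zero (by norm_num) (by rw [hL]; linarith)
  · rw [div_le_iff₀ (by positivity)]
    linarith
  · rw [Fintype.card_fin, hL, hkx]
    exact mul_sq_two_div_cube_le (by positivity) hx
  · have h_exponent : -L ^ 2 / (8 * (√n * ρ) ^ 2) = -(8 * Real.log x) := by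
      rw [hL, hε]
      field_simp
      norm_num
    rw [Fintype.card_fin, h_exponent]
    exact two_mul_exp_neg_eight_mul_log_le hx
      (hkx.trans_le (mul_le_of_le_one_right (by linarith) (by linarith)))

theorem Protocol.div_le_of_communicationComplexity_le {Ω R : Type*}
    [MeasurableSpace Ω] [MeasurableSpace R] {k m n B : ℕ} {ρ : ℝ} {μ₀ : Measure Ω}
    {μ : Fin k → Measure Ω} (π : Protocol m k (Fin n → Ω) R) (h : IsCenteredFamily ρ μ₀ μ)
    (hn : 1 ≤ n) (hρ : ρ ≤ ((n : ℝ) * Real.log k) ^ (-(1 / 2 : ℝ)) / 10 ^ 7)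
    (hcorr : CorrCondition n ρ μ₀ μ) (hπ : π.Identifies μ (1 / 3))
    (hB : π.communicationComplexity ≤ B) :
    k / (10 ^ 7 * ρ ^ 2 * n * Real.log (k / (n * ρ ^ 2))) ≤ (B : ℝ) := by
  have := h.prob_center
  have := h.prob
  have hk : (2 : ℝ) ≤ k := by exact_mod_cast h.two_le
  have hn1 : (1 : ℝ) ≤ n := by exact_mod_cast hn
  have hρ0 := h.rho_pos
  have hq : 0 < n * ρ ^ 2 := by positivity
  obtain ⟨hq_le, hqx⟩ := mul_log_div_le_of_mul_log_le hk hq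
    (mul_sq_mul_log_le (by linarith) hρ0.le (by linarith) hρ)
  set x : ℝ := k / (n * ρ ^ 2)
  have hkx : k = x * (n * ρ ^ 2) := (div_mul_cancel₀ _ hq.ne').symm
  have hx : 100 ≤ x := (le_div_iff₀ hq).2 (by linarith)
  have h_log := four_le_log_of_hundred_le hx
  have hδ1 : 2 / x ^ 3 < 1 := (div_lt_one (by positivity)).2 <|
    calc (2 : ℝ) < 100 ^ 3 := by norm_num
      _ ≤ x ^ 3 := by gcongr
  obtain ⟨G, hG, hG₀, hGi, hM⟩ := h.exists_hasLevelOneBound_cond hn hcorr hkx hx hq_le hqx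
  have h_upper := π.sum_measureReal_outputs_le_of_hasLevelOneBound hB hG (by positivity) hδ1
    hG₀ hGi hM (a := 12) (by norm_num)
  have h_success : 2 / 3 * (k : ℝ) ≤ ∑ i, (π.coins.prod
      (Measure.pi fun _ : Fin m => Measure.pi fun _ : Fin n => μ i)).real
        {p | π.Outputs p.1 p.2 i} :=
    calc 2 / 3 * (k : ℝ) = ∑ _i : Fin k, (1 - 1 / 3 : ℝ) := by
          rw [Finset.sum_const, Finset.card_univ, Fintype.card_fin, nsmul_eq_mul]; ring
      _ ≤ _ := Finset.sum_le_sum fun i _ => hπ i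
  rw [div_le_iff₀ (by positivity)]
  linarith [le_of_two_thirds_mul_le hk hq hkx hx hqx B.cast_nonneg (h_success.trans h_upper)]

theorem theorem1 :
    ∃ C C' : ℝ, 0 < C ∧ 0 < C' ∧
      ∀ (Ω : Type*) [MeasurableSpace Ω] (k : ℕ) (ρ : ℝ) (μ₀ : Measure Ω) (μ : Fin k → Measure Ω),
        IsCenteredFamily ρ μ₀ μ →
        ∀ n : ℕ, 1 ≤ n →
          (ρ ≤ ((n : ℝ) * Real.log k) ^ (-(1 / 2 : ℝ)) / C' →
            CorrCondition n ρ μ₀ μ →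
            ∀ (m : ℕ), 1 ≤ m →
              ∀ (R : Type*) [MeasurableSpace R] (π : Protocol m k (Fin n → Ω) R),
                π.Identifies μ (1 / 3) →
                ENNReal.ofReal
                    ((k : ℝ) / (C * ρ ^ 2 * n * Real.log ((k : ℝ) / (n * ρ ^ 2)))) ≤
                  (π.communicationComplexity : ℝ≥0∞)) ∧
          ((∃ ℓ : ℕ, 2 ≤ ℓ ∧
              (∀ S : Finset (Fin k), 2 ≤ S.card → S.card ≤ ℓ → corrTerm n ρ μ₀ μ S = 0) ∧
              (k : ℝ) ^ (2 * ((ℓ : ℝ) + 1) / ((ℓ : ℝ) - 1)) ≤ n) →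
            CorrCondition n ρ μ₀ μ) := by
  refine ⟨10 ^ 7, 10 ^ 7, by norm_num, by norm_num, fun Ω _ k ρ μ₀ μ h n hn =>
    ⟨fun hρ hcorr m _ R _ π hπ => ?_, fun ⟨ℓ, hℓ, h_zero, hk⟩ =>
      h.corrCondition_of_corrTerm_eq_zero hn hℓ h_zero hk⟩⟩
  rcases eq_or_ne π.communicationComplexity ⊤ with h_top | h_ne_top
  · rw [h_top, ENat.toENNReal_top]
    exact le_top
  obtain ⟨B, hB⟩ := ENat.ne_top_iff_exists.1 h_ne_top
  rw [← hB, ENat.toENNReal_coe, ← ENNReal.ofReal_natCast]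
  exact ENNReal.ofReal_le_ofReal
    (π.div_le_of_communicationComplexity_le h hn hρ hcorr hπ hB.ge)
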